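/- Let $\mathcal S,\mathcal X,\mathcal Y_1,\mathcal Y_2$ be finite sets, $P_S$ a pmf on $\mathcal S$, $P_{Y_1Y_2|XS}$ a transition probability from $\mathcal X\times\mathcal S$ to $\mathcal Y_1\times\mathcal Y_2$, $\phi:\mathcal X\to[0,\infty)$ a cost function and $\Gamma>0$. All logarithms are to base $2$. For $n\ge 1$ and $R_0,R_1,R_2\ge 0$ let $\mathcal I_{R}=\{1,\dots,\lfloor 2^{nR}\rfloor\}$. A $(2^{nR_0},2^{nR_1},2^{nR_2},n)$ code consists of an encoder $x^n(m_0,m_1,m_2,s^n)\in\mathcal X^n$, defined for all $(m_0,m_1,m_2,s^n)\in\mathcal I_{R_0}\times\mathcal I_{R_1}\times\mathcal I_{R_2}\times\mathcal S^n$, and of two decoders, which map $y_1^n\in\mathcal Y_1^n$ to $(\hat m_{01},\hat m_1)\in\mathcal I_{R_0}\times\mathcal I_{R_1}$ and $y_2^n\in\mathcal Y_2^n$ to $(\hat m_{02},\hat m_2)\in\mathcal I_{R_0}\times\mathcal I_{R_2}$. The messages $(M_0,M_1,M_2)$ are uniformly distributed on $\mathcal I_{R_0}\times\mathcal I_{R_1}\times\mathcal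 I_{R_2}$, the state sequence $S^n$ is i.i.d. with law $P_S$ and independent of the messages, $X^n=x^n(M_0,M_1,M_2,S^n)$, and, given $(M_0,M_1,M_2,S^n)$, the outputs have law $\prod_{i=1}^n P_{Y_1Y_2|XS}(y_{1i},y_{2i}|X_i,S_i)$. Put $P_e^{(n)}=\Pr\big[\bigcup_{k=1}^2\{(\hat M_{0k},\hat M_k)\ne(M_0,M_k)\}\big]$. A quintuple $(R_0,R_1,R_2,E_1,E_2)$ of real numbers with $R_0,R_1,R_2\ge 0$ is achievable if for every $\epsilon>0$ and all sufficiently large $n$ there is a $(2^{nR_0},2^{nR_1},2^{nR_2},n)$ code with $\frac1n\sum_{i=1}^n\phi(X_i)\le\Gamma$ almost surely, $P_e^{(n)}\le\epsilon$, and $\frac1n I(S^n;Y_k^n)\le E_k+\epsilon$ for $k=1,2$. Claim: if $(R_0,R_1,R_2,E_1,E_2)$ is achievable, then there are finite sets $\mathcal W,\mathcal U,\mathcal V$ and a conditional distribution $P_{WUVX|S}$ on $\mathcal W\times\mathcal U\times\mathcal V\times\mathcal X$ such that, for $(S,W,U,V,X,Y_1,Y_2)$ with joint law $P_S\,P_{WUVX|S}\,P_{Y_1Y_2|XS}$,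 $$R_0\le \min\{I(W;Y_1|S),I(W;Y_2|S)\},$$ $$R_0+R_1\le \min\{I(W;Y_1|S),I(W;Y_2|S)\}+I(U;Y_1|W,S),$$ $$R_0+R_2\le \min\{I(W;Y_1|S),I(W;Y_2|S)\}+I(V;Y_2|W,S),$$ $$R_0+R_1+R_2\le \min\{I(W;Y_1|S),I(W;Y_2|S)\}+I(U;Y_1|W,S)+I(X;Y_2|W,U,S),$$ $$R_0+R_1+R_2\le \min\{I(W;Y_1|S),I(W;Y_2|S)\}+I(X;Y_1|W,V,S)+I(V;Y_2|W,S),$$ $$E_k\ge I(S;Y_k),\qquad k=1,2.$$ -/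

import Mathlib

/-! Probability mass functions on a finite set `Ω` are the elements of `stdSimplex ℝ Ω`; a random
variable on the finite probability space `(Ω, p)` is a function on `Ω`. All logarithms are to
base two, so that rates and information quantities are in bits. -/

noncomputable section

open scoped NNReal

namespace StateMasking

section Information

variable {Ω A B C : Type*} [Fintype Ω] [Fintype A] [Fintype B] [Fintype C]

open Classical in
/-- The probability of an event. -/
def prob (p : Ω → ℝ) (E : Set Ω) : ℝ := ∑ ω, if ω ∈ E then p ω else 0

/-- The pmf of the random variable `X`. -/
def law (p : Ω → ℝ) (X : Ω → A) (a : A) : ℝ := prob p {ω | X ω = a}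

/-- Entropy `H(X) = - ∑ P(a) log P(a)`. -/
def entropy (p : Ω → ℝ) (X : Ω → A) : ℝ := - ∑ a, law p X a * Real.logb 2 (law p X a)

/-- Conditional entropy `H(X | Y) = - ∑ P(a, b) log (P(a, b) / P(b))`. -/
def condEntropy (p : Ω → ℝ) (X : Ω → A) (Y : Ω → B) : ℝ :=
  - ∑ a, ∑ b, law p (fun ω => (X ω, Y ω)) (a, b) *
      Real.logb 2 (law p (fun ω => (X ω, Y ω)) (a, b) / law p Y b)

/-- Mutual information `I(X; Y) = H(X) - H(X | Y)`. -/
def mutualInfo (p : Ω → ℝ) (X : Ω → A) (Y : Ω → B) : ℝ := entropy p X - condEntropy p X Y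

/-- Conditional mutual information `I(X; Y | Z) = H(X | Z) - H(X | Y, Z)`. -/
def condMutualInfo (p : Ω → ℝ) (X : Ω → A) (Y : Ω → B) (Z : Ω → C) : ℝ :=
  condEntropy p X Z - condEntropy p X (fun ω => (Y ω, Z ω))

end Information

section Channel

variable {S X Y₁ Y₂ : Type*} [Fintype S] [Fintype Y₁] [Fintype Y₂]

/-- A two-receiver discrete memoryless broadcast channel with random parameters: the state pmf
`P_S` and the transition function `P_{Y₁ Y₂ | X S}`. -/
structure Channel (S X Y₁ Y₂ : Type*) [Fintype S] [Fintype Y₁] [Fintype Y₂] where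
  /-- `P_S(s)` -/
  stateP : S → ℝ
  stateP_mem : stateP ∈ stdSimplex ℝ S
  /-- `P_{Y₁ Y₂ | X S}(y₁, y₂ | x, s)` -/
  trans : X → S → Y₁ × Y₂ → ℝ
  trans_mem : ∀ x s, trans x s ∈ stdSimplex ℝ (Y₁ × Y₂)

/-- The message set `{1, ..., 2^{nR}}`, with `⌊2^{nR}⌋` elements. -/
abbrev Msg (n : ℕ) (R : ℝ) : Type := Fin ⌊(2 : ℝ) ^ ((n : ℝ) * R)⌋₊

/-- A block code of length `n` with message sets `M₀`, `M₁`, `M₂`, whose encoder knows the whole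
state sequence. -/
structure Code (n : ℕ) (M₀ M₁ M₂ S X Y₁ Y₂ : Type*) where
  enc : M₀ → M₁ → M₂ → (Fin n → S) → (Fin n → X)
  dec₁ : (Fin n → Y₁) → M₀ × M₁
  dec₂ : (Fin n → Y₂) → M₀ × M₂

/-- Outcomes of one block transmission: the messages, the state sequence and the two received
sequences. -/
structure Outcome (n : ℕ) (M₀ M₁ M₂ S Y₁ Y₂ : Type*) where
  m₀ : M₀
  m₁ : M₁
  m₂ : M₂
  s : Fin n → S
  y₁ : Fin n → Y₁
  y₂ : Fin n → Y₂

/-- Outcomes as tuples. -/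
def Outcome.equiv (n : ℕ) (M₀ M₁ M₂ S Y₁ Y₂ : Type*) :
    Outcome n M₀ M₁ M₂ S Y₁ Y₂ ≃
      M₀ × M₁ × M₂ × (Fin n → S) × (Fin n → Y₁) × (Fin n → Y₂) where
  toFun ω := (ω.m₀, ω.m₁, ω.m₂, ω.s, ω.y₁, ω.y₂)
  invFun t := ⟨t.1, t.2.1, t.2.2.1, t.2.2.2.1, t.2.2.2.2.1, t.2.2.2.2.2⟩
  left_inv _ := rfl
  right_inv _ := rfl

instance (n : ℕ) (M₀ M₁ M₂ S Y₁ Y₂ : Type*) [Fintype M₀] [Fintype M₁] [Fintype M₂] [Fintype S]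
    [Fintype Y₁] [Fintype Y₂] : Fintype (Outcome n M₀ M₁ M₂ S Y₁ Y₂) :=
  Fintype.ofEquiv _ (Outcome.equiv n M₀ M₁ M₂ S Y₁ Y₂).symm

namespace Code

variable {n : ℕ} {M₀ M₁ M₂ : Type*} [Fintype M₀] [Fintype M₁] [Fintype M₂]

/-- The channel input sequence `X^n`. -/
def input (c : Code n M₀ M₁ M₂ S X Y₁ Y₂) (ω : Outcome n M₀ M₁ M₂ S Y₁ Y₂) : Fin n → X :=
  c.enc ω.m₀ ω.m₁ ω.m₂ ω.s

/-- The joint pmf of messages, states and channel outputs: the messages are uniform, the states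
are i.i.d. and independent of the messages, and the channel is memoryless without feedback. -/
def joint (c : Code n M₀ M₁ M₂ S X Y₁ Y₂) (ch : Channel S X Y₁ Y₂)
    (ω : Outcome n M₀ M₁ M₂ S Y₁ Y₂) : ℝ :=
  ((Fintype.card M₀ : ℝ) * Fintype.card M₁ * Fintype.card M₂)⁻¹ *
    (∏ i, ch.stateP (ω.s i)) * ∏ i, ch.trans (c.input ω i) (ω.s i) (ω.y₁ i, ω.y₂ i)

/-- The average probability that at least one receiver decodes its message pair wrongly. -/
def errorProb (c : Code n M₀ M₁ M₂ S X Y₁ Y₂) (ch : Channel S X Y₁ Y₂) : ℝ :=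
  prob (c.joint ch) {ω | c.dec₁ ω.y₁ ≠ (ω.m₀, ω.m₁) ∨ c.dec₂ ω.y₂ ≠ (ω.m₀, ω.m₂)}

end Code

/-- Achievability of `(R₀, R₁, R₂, E₁, E₂)` under the input cost function `φ` and budget `Γ`. The
cost constraint holds for every input sequence of positive probability. -/
def Achievable (ch : Channel S X Y₁ Y₂) (φ : X → ℝ≥0) (Γ : ℝ) (R₀ R₁ R₂ E₁ E₂ : ℝ) : Prop :=
  0 ≤ R₀ ∧ 0 ≤ R₁ ∧ 0 ≤ R₂ ∧
  ∀ ε : ℝ, 0 < ε → ∃ N : ℕ, ∀ n : ℕ, N ≤ n →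
    ∃ c : Code n (Msg n R₀) (Msg n R₁) (Msg n R₂) S X Y₁ Y₂,
      (∀ ω, 0 < c.joint ch ω → (1 / n : ℝ) * ∑ i, (φ (c.input ω i) : ℝ) ≤ Γ) ∧
      c.errorProb ch ≤ ε ∧
      (1 / n : ℝ) * mutualInfo (c.joint ch) (fun ω => ω.s) (fun ω => ω.y₁) ≤ E₁ + ε ∧
      (1 / n : ℝ) * mutualInfo (c.joint ch) (fun ω => ω.s) (fun ω => ω.y₂) ≤ E₂ + ε

/-- The joint pmf `P_S(s) P_{W U V X | S}(w, u, v, x | s) P_{Y₁ Y₂ | X S}(y₁, y₂ | x, s)`. -/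
def letterJoint {W U V : Type*} (ch : Channel S X Y₁ Y₂) (P : S → W × U × V × X → ℝ) :
    S × W × U × V × X × Y₁ × Y₂ → ℝ :=
  fun (s, w, u, v, x, y₁, y₂) => ch.stateP s * P s (w, u, v, x) * ch.trans x s (y₁, y₂)

end Channel

section Coordinates

/-! The coordinate random variables of the single-letter joint distribution. -/

variable {S W U V X Y₁ Y₂ : Type*}

/-- The state. -/
def rvS (ω : S × W × U × V × X × Y₁ × Y₂) : S := ω.1
/-- The first auxiliary variable. -/
def rvW (ω : S × W × U × V × X × Y₁ × Y₂) : W := ω.2.1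
/-- The second auxiliary variable. -/
def rvU (ω : S × W × U × V × X × Y₁ × Y₂) : U := ω.2.2.1
/-- The third auxiliary variable. -/
def rvV (ω : S × W × U × V × X × Y₁ × Y₂) : V := ω.2.2.2.1
/-- The channel input. -/
def rvX (ω : S × W × U × V × X × Y₁ × Y₂) : X := ω.2.2.2.2.1
/-- The first channel output. -/
def rvY₁ (ω : S × W × U × V × X × Y₁ × Y₂) : Y₁ := ω.2.2.2.2.2.1
/-- The second channel output. -/
def rvY₂ (ω : S × W × U × V × X × Y₁ × Y₂) : Y₂ := ω.2.2.2.2.2.2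

end Coordinates

end StateMasking

end

/-! Let `Wᵢ` collect `M₀`, the whole state sequence, the past of the first output sequence and the
future of the second one. Fano's inequality and the Csiszár sum identity, applied with these `Wᵢ`
and with `U = M₁`, `V = M₂`, give the single-letter bounds averaged over `i`, up to a slack that
vanishes with the block length; the alphabets of the auxiliary variables, however, grow with it.

The bounds depend on the auxiliary variables only through a point of a fixed finite-dimensional
space: the pmf of `(S, X)` and the pairs of output entropies given `(W, S)`, `(U, W, S)` and
`(V, W, S)`. These points lie in a convex set built from the graph of
`q ↦ (H(Y₁ | S), H(Y₂ | S))` by taking convex hulls twice. It is compact by Carathéodory's theorem,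
so the slack disappears in the limit, and each of its points is an iterated finite convex
combination, hence comes from auxiliary variables with finite alphabets, for which `U` and `V` may
be taken conditionally independent given `(W, S, X)`. -/

noncomputable section

open scoped NNReal

namespace StateMasking

section Law

variable {Ω A B C : Type*} [Fintype Ω] {p : Ω → ℝ}

open Classical in
theorem law_eq_sum (p : Ω → ℝ) (X : Ω → A) (a : A) :
    law p X a = ∑ ω, if X ω = a then p ω else 0 := by
  simp only [law, prob, Set.mem_ofPred_eq]

theorem prob_mono (hp : ∀ ω, 0 ≤ p ω) {E F : Set Ω} (h : E ⊆ F) : prob p E ≤ prob p F := by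
  classical
  refine Finset.sum_le_sum fun ω _ => ?_
  by_cases hE : ω ∈ E
  · simp [hE, h hE]
  · rw [if_neg hE]
    split_ifs <;> simp [hp]

theorem prob_nonneg (hp : ∀ ω, 0 ≤ p ω) (E : Set Ω) : 0 ≤ prob p E := by
  simpa [prob] using prob_mono hp (Set.empty_subset E)

theorem law_nonneg (hp : ∀ ω, 0 ≤ p ω) (X : Ω → A) (a : A) : 0 ≤ law p X a :=
  prob_nonneg hp _

theorem law_mono (hp : ∀ ω, 0 ≤ p ω) {X : Ω → A} {Y : Ω → B} {a : A} {b : B}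
    (h : ∀ ω, X ω = a → Y ω = b) : law p X a ≤ law p Y b :=
  prob_mono hp h

theorem le_law (hp : ∀ ω, 0 ≤ p ω) (X : Ω → A) (ω : Ω) : p ω ≤ law p X (X ω) := by
  classical
  calc p ω = law p id ω := by simp [law_eq_sum]
    _ ≤ law p X (X ω) := law_mono hp fun ω' h => congrArg X h

theorem law_pos (hp : ∀ ω, 0 ≤ p ω) (X : Ω → A) {ω : Ω} (hω : 0 < p ω) : 0 < law p X (X ω) :=
  hω.trans_le (le_law hp X ω)

theorem law_congr (p : Ω → ℝ) {X : Ω → A} {Y : Ω → B} {a : A} {b : B}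
    (h : ∀ ω, X ω = a ↔ Y ω = b) : law p X a = law p Y b := by
  simp only [law, h]

theorem sum_mul_comp [Fintype A] (p : Ω → ℝ) (X : Ω → A) (g : A → ℝ) :
    ∑ ω, p ω * g (X ω) = ∑ a, law p X a * g a := by
  classical
  simp_rw [law_eq_sum, Finset.sum_mul]
  rw [Finset.sum_comm]
  simp [ite_mul]

theorem sum_law [Fintype A] (p : Ω → ℝ) (X : Ω → A) : ∑ a, law p X a = ∑ ω, p ω := by
  simpa using (sum_mul_comp p X fun _ => 1).symm

open Classical in
theorem law_pair_comp_left [Fintype A] (p : Ω → ℝ) (X : Ω → A) (Y : Ω → B) (f : A → C) (b : B)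
    (c : C) : law p (fun ω => (f (X ω), Y ω)) (c, b) =
      ∑ a, if f a = c then law p (fun ω => (X ω, Y ω)) (a, b) else 0 := by
  simp only [law_eq_sum, Finset.ite_sum_zero, ← ite_and, Prod.mk.injEq]
  rw [Finset.sum_comm]
  refine Finset.sum_congr rfl fun ω _ => ?_
  rw [Finset.sum_eq_single (X ω)] <;> simp +contextual [eq_comm]

theorem sum_law_pair_left [Fintype A] (p : Ω → ℝ) (X : Ω → A) (Y : Ω → B) (b : B) :
    ∑ a, law p (fun ω => (X ω, Y ω)) (a, b) = law p Y b := by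
  simpa using (law_pair_comp_left p X Y (fun _ => ()) b ()).symm.trans (law_congr p (by simp))

theorem sum_law_pair_right [Fintype B] (p : Ω → ℝ) (X : Ω → A) (Y : Ω → B) (a : A) :
    ∑ b, law p (fun ω => (X ω, Y ω)) (a, b) = law p X a := by
  rw [← sum_law_pair_left p Y X]
  exact Finset.sum_congr rfl fun b _ => law_congr p (by simp [and_comm])

end Law

section Entropy

variable {Ω A B C : Type*} [Fintype Ω] [Fintype A] [Fintype B] [Fintype C] {p : Ω → ℝ}

theorem entropy_eq_sum (p : Ω → ℝ) (X : Ω → A) :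
    entropy p X = -∑ ω, p ω * Real.logb 2 (law p X (X ω)) := by
  rw [entropy, ← sum_mul_comp p X fun a => Real.logb 2 (law p X a)]

theorem condEntropy_eq_sum (p : Ω → ℝ) (X : Ω → A) (Y : Ω → B) :
    condEntropy p X Y = -∑ ω, p ω * Real.logb 2
      (law p (fun ω => (X ω, Y ω)) (X ω, Y ω) / law p Y (Y ω)) := by
  have h := sum_mul_comp p (fun ω => (X ω, Y ω)) fun z =>
    Real.logb 2 (law p (fun ω => (X ω, Y ω)) z / law p Y z.2)
  rw [condEntropy, h, Fintype.sum_prod_type]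

theorem entropy_congr (p : Ω → ℝ) {X : Ω → A} {Y : Ω → B}
    (h : ∀ ω ω', X ω = X ω' ↔ Y ω = Y ω') : entropy p X = entropy p Y := by
  rw [entropy_eq_sum, entropy_eq_sum]
  simp_rw [fun ω => law_congr p fun ω' => h ω' ω]

theorem condEntropy_congr_right (p : Ω → ℝ) (X : Ω → A) {Y : Ω → B} {Z : Ω → C}
    (h : ∀ ω ω', Y ω = Y ω' ↔ Z ω = Z ω') : condEntropy p X Y = condEntropy p X Z := by
  have hpair (ω : Ω) : law p (fun ω => (X ω, Y ω)) (X ω, Y ω) =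
      law p (fun ω => (X ω, Z ω)) (X ω, Z ω) :=
    law_congr p fun ω' => by simp only [Prod.mk.injEq, h]
  rw [condEntropy_eq_sum, condEntropy_eq_sum]
  simp_rw [hpair, fun ω => law_congr p fun ω' => h ω' ω]

theorem entropy_le_of_factorsThrough (hp : ∀ ω, 0 ≤ p ω) {X : Ω → A} {Y : Ω → B}
    (h : Y.FactorsThrough X) : entropy p Y ≤ entropy p X := by
  rw [entropy_eq_sum, entropy_eq_sum, neg_le_neg_iff]
  refine Finset.sum_le_sum fun ω _ => ?_
  rcases (hp ω).eq_or_lt with h0 | h0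
  · simp [← h0]
  · exact mul_le_mul_of_nonneg_left (Real.logb_le_logb_of_le one_lt_two (law_pos hp X h0)
      (law_mono hp fun ω' h' => h h')) h0.le

theorem condEntropy_eq_sub (hp : ∀ ω, 0 ≤ p ω) (X : Ω → A) (Y : Ω → B) :
    condEntropy p X Y = entropy p (fun ω => (X ω, Y ω)) - entropy p Y := by
  rw [condEntropy_eq_sum, entropy_eq_sum, entropy_eq_sum, neg_sub_neg, neg_eq_iff_eq_neg, neg_sub,
    ← Finset.sum_sub_distrib]
  refine Finset.sum_congr rfl fun ω _ => ?_
  rcases (hp ω).eq_or_lt with h0 | h0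
  · simp [← h0]
  · rw [Real.logb_div (law_pos hp (fun ω => (X ω, Y ω)) h0).ne' (law_pos hp Y h0).ne', mul_sub]

theorem condEntropy_le_of_factorsThrough_left (hp : ∀ ω, 0 ≤ p ω) {X : Ω → A} {X' : Ω → B}
    (h : X'.FactorsThrough X) (Y : Ω → C) : condEntropy p X' Y ≤ condEntropy p X Y := by
  rw [condEntropy_eq_sub hp, condEntropy_eq_sub hp, sub_le_sub_iff_right]
  refine entropy_le_of_factorsThrough hp fun ω ω' hω => ?_
  simp only [Prod.mk.injEq] at hω ⊢
  exact ⟨h hω.1, hω.2⟩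

theorem condEntropy_pair (hp : ∀ ω, 0 ≤ p ω) (X : Ω → A) (Y : Ω → B) (Z : Ω → C) :
    condEntropy p (fun ω => (X ω, Y ω)) Z =
      condEntropy p X (fun ω => (Y ω, Z ω)) + condEntropy p Y Z := by
  rw [condEntropy_eq_sub hp, condEntropy_eq_sub hp, condEntropy_eq_sub hp, sub_add_sub_cancel,
    entropy_congr p (Y := fun ω => (X ω, Y ω, Z ω)) (by simp [and_assoc])]

theorem sum_mul_logb_nonpos {r : Ω → ℝ} (hp : ∀ ω, 0 ≤ p ω) (hr : ∀ ω, 0 < p ω → 0 < r ω)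
    (h : ∑ ω, p ω * r ω ≤ ∑ ω, p ω) : ∑ ω, p ω * Real.logb 2 (r ω) ≤ 0 := by
  have hterm (ω : Ω) : p ω * Real.logb 2 (r ω) ≤ (p ω * r ω - p ω) / Real.log 2 := by
    rcases (hp ω).eq_or_lt with h0 | h0
    · simp [← h0]
    · rw [← mul_sub_one, mul_div_assoc, Real.logb]
      have hlog := Real.log_le_sub_one_of_pos (hr ω h0)
      have := Real.log_pos one_lt_two
      gcongr
  calc ∑ ω, p ω * Real.logb 2 (r ω) ≤ (∑ ω, p ω * r ω - ∑ ω, p ω) / Real.log 2 := by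
        rw [← Finset.sum_sub_distrib, Finset.sum_div]
        exact Finset.sum_le_sum fun ω _ => hterm ω
    _ ≤ 0 := div_nonpos_of_nonpos_of_nonneg (sub_nonpos.2 h) (Real.log_pos one_lt_two).le

theorem sum_mul_likelihoodRatio_le {D : Type*} [Finite D] (hp : ∀ ω, 0 ≤ p ω) (X : Ω → A)
    (Y : Ω → D) {Q : A → D → ℝ} (hQ : ∀ a d, 0 ≤ Q a d) (hsum : ∀ d, ∑ a, Q a d ≤ 1) :
    ∑ ω, p ω * (Q (X ω) (Y ω) /
      (law p (fun ω => (X ω, Y ω)) (X ω, Y ω) / law p Y (Y ω))) ≤ ∑ ω, p ω := by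
  cases nonempty_fintype D
  set Z : Ω → A × D := fun ω => (X ω, Y ω)
  calc ∑ ω, p ω * (Q (X ω) (Y ω) / (law p Z (Z ω) / law p Y (Y ω)))
      = ∑ z : A × D, law p Z z * (Q z.1 z.2 / (law p Z z / law p Y z.2)) :=
        sum_mul_comp p Z fun z => Q z.1 z.2 / (law p Z z / law p Y z.2)
    _ ≤ ∑ z : A × D, Q z.1 z.2 * law p Y z.2 := by
        refine Finset.sum_le_sum fun z _ => ?_
        rcases (law_nonneg hp Z z).eq_or_lt with h0 | h0
        · rw [← h0, zero_mul]
          exact mul_nonneg (hQ _ _) (law_nonneg hp _ _)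
        · exact le_of_eq (by field_simp)
    _ = ∑ d, (∑ a, Q a d) * law p Y d := by
        simp_rw [Fintype.sum_prod_type_right, Finset.sum_mul]
    _ ≤ ∑ d, 1 * law p Y d := by
        gcongr with d
        exacts [law_nonneg hp _ _, hsum d]
    _ = ∑ ω, p ω := by simp [sum_law]

theorem condEntropy_le_neg_sum_mul_logb (hp : ∀ ω, 0 ≤ p ω) (X : Ω → A) (Y : Ω → B)
    {Q : A → B → ℝ} (hQ : ∀ a b, 0 ≤ Q a b) (hpos : ∀ ω, 0 < p ω → 0 < Q (X ω) (Y ω))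
    (hsum : ∀ b, ∑ a, Q a b ≤ 1) :
    condEntropy p X Y ≤ -∑ ω, p ω * Real.logb 2 (Q (X ω) (Y ω)) := by
  have hlaw (ω : Ω) (h0 : 0 < p ω) :
      0 < law p (fun ω => (X ω, Y ω)) (X ω, Y ω) / law p Y (Y ω) :=
    div_pos (law_pos hp (fun ω => (X ω, Y ω)) h0) (law_pos hp Y h0)
  rw [condEntropy_eq_sum, neg_le_neg_iff, ← sub_nonpos, ← Finset.sum_sub_distrib]
  refine le_of_eq_of_le (Finset.sum_congr rfl fun ω _ => ?_) (sum_mul_logb_nonpos hp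
    (fun ω h0 => div_pos (hpos ω h0) (hlaw ω h0)) (sum_mul_likelihoodRatio_le hp X Y hQ hsum))
  rcases (hp ω).eq_or_lt with h0 | h0
  · simp [← h0]
  · rw [Real.logb_div (hpos ω h0).ne' (hlaw ω h0).ne', mul_sub]

theorem condEntropy_pair_right_le (hp : ∀ ω, 0 ≤ p ω) (X : Ω → A) (Y : Ω → B) (Z : Ω → C) :
    condEntropy p X (fun ω => (Y ω, Z ω)) ≤ condEntropy p X Z := by
  rw [condEntropy_eq_sum p X Z]
  exact condEntropy_le_neg_sum_mul_logb hp X (fun ω => (Y ω, Z ω))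
    (Q := fun a b => law p (fun ω => (X ω, Z ω)) (a, b.2) / law p Z b.2)
    (fun a b => div_nonneg (law_nonneg hp _ _) (law_nonneg hp _ _))
    (fun ω h0 => div_pos (law_pos hp (fun ω => (X ω, Z ω)) h0) (law_pos hp Z h0))
    (fun b => by rw [← Finset.sum_div, sum_law_pair_left]; exact div_self_le_one _)

theorem condEntropy_le_of_factorsThrough_right (hp : ∀ ω, 0 ≤ p ω) (X : Ω → A) {Y : Ω → B}
    {Z : Ω → C} (h : Z.FactorsThrough Y) : condEntropy p X Y ≤ condEntropy p X Z := by
  rw [condEntropy_congr_right p X (Z := fun ω => (Y ω, Z ω))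
    fun ω ω' => by simpa only [Prod.mk.injEq, iff_self_and] using @h ω ω']
  exact condEntropy_pair_right_le hp X Y Z

theorem condMutualInfo_comm (hp : ∀ ω, 0 ≤ p ω) (X : Ω → A) (Y : Ω → B) (Z : Ω → C) :
    condMutualInfo p X Y Z = condMutualInfo p Y X Z := by
  have h := condEntropy_pair hp X Y Z
  have hswap : condEntropy p (fun ω => (X ω, Y ω)) Z = condEntropy p (fun ω => (Y ω, X ω)) Z := by
    rw [condEntropy_eq_sub hp, condEntropy_eq_sub hp,
      entropy_congr p (Y := fun ω => ((Y ω, X ω), Z ω)) (by simp [and_comm])]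
  rw [hswap, condEntropy_pair hp Y X Z] at h
  rw [condMutualInfo, condMutualInfo]
  linarith

theorem condMutualInfo_eq_condEntropy_sub (hp : ∀ ω, 0 ≤ p ω) (X : Ω → A) (Y : Ω → B)
    (Z : Ω → C) : condMutualInfo p X Y Z =
      condEntropy p Y Z - condEntropy p Y fun ω => (X ω, Z ω) :=
  condMutualInfo_comm hp X Y Z

theorem condEntropy_le_condMutualInfo_add (hp : ∀ ω, 0 ≤ p ω) (X : Ω → A) (Y : Ω → B)
    (Z : Ω → C) : condEntropy p X Z ≤ condMutualInfo p Y X Z + condEntropy p X Y := by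
  have h := condEntropy_le_of_factorsThrough_right hp X (Y := fun ω => (Y ω, Z ω)) (Z := Y)
    fun _ _ h => congrArg Prod.fst h
  rw [condMutualInfo_eq_condEntropy_sub hp]
  linarith

theorem logb_card_nonneg (A : Type*) [Fintype A] [Nonempty A] :
    0 ≤ Real.logb 2 (Fintype.card A) :=
  Real.logb_nonneg one_lt_two (Nat.one_le_cast.2 Fintype.card_pos)

theorem condEntropy_eq_logb_card (hp : ∀ ω, 0 ≤ p ω) (hp1 : ∑ ω, p ω = 1) {X : Ω → A}
    {Y : Ω → B} (h : ∀ a a' b, law p (fun ω => (X ω, Y ω)) (a, b) =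
      law p (fun ω => (X ω, Y ω)) (a', b)) :
    condEntropy p X Y = Real.logb 2 (Fintype.card A) := by
  have hcond (ω : Ω) : law p Y (Y ω) =
      Fintype.card A * law p (fun ω => (X ω, Y ω)) (X ω, Y ω) := by
    rw [← sum_law_pair_left p X Y, Finset.sum_congr rfl fun a _ => h a (X ω) (Y ω)]
    simp
  have hterm (ω : Ω) : p ω * Real.logb 2
      (law p (fun ω => (X ω, Y ω)) (X ω, Y ω) / law p Y (Y ω)) =
      p ω * -Real.logb 2 (Fintype.card A) := by
    rcases (hp ω).eq_or_lt with h0 | h0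
    · simp [← h0]
    · have hpos := law_pos hp (fun ω => (X ω, Y ω)) h0
      rw [hcond, div_mul_cancel_right₀ hpos.ne', Real.logb_inv]
  rw [condEntropy_eq_sum, Finset.sum_congr rfl fun ω _ => hterm ω, ← Finset.sum_mul, hp1, one_mul,
    neg_neg]

theorem fano (hp : ∀ ω, 0 ≤ p ω) (hp1 : ∑ ω, p ω = 1) (X : Ω → A) (Y : Ω → B) (g : B → A) :
    condEntropy p X Y ≤
      1 + prob p {ω | g (Y ω) ≠ X ω} * Real.logb 2 (Fintype.card A) := by
  classical
  rcases isEmpty_or_nonempty A with hA | hA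
  · have := Function.isEmpty X
    simp at hp1
  -- Compare with the conditional pmf giving mass `1 / 2` to the guess `g b` and spreading the
  -- other half uniformly over `A`.
  have hsum (b : B) : ∑ a, (if g b = a then (2 : ℝ)⁻¹ else (2 * (Fintype.card A : ℝ))⁻¹) ≤ 1 :=
    calc ∑ a, (if g b = a then (2 : ℝ)⁻¹ else (2 * (Fintype.card A : ℝ))⁻¹)
        ≤ ∑ a, ((if g b = a then (2 : ℝ)⁻¹ else 0) + (2 * (Fintype.card A : ℝ))⁻¹) := by
          gcongr with a
          split_ifs <;> simp
      _ = 1 := by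
          simp only [Finset.sum_add_distrib, Finset.sum_ite_eq, Finset.mem_univ, if_true,
            Finset.sum_const, Finset.card_univ, nsmul_eq_mul]
          field_simp
          norm_num
  have hQ (a : A) (b : B) : 0 < if g b = a then (2 : ℝ)⁻¹ else (2 * (Fintype.card A : ℝ))⁻¹ := by
    split_ifs <;> positivity
  refine (condEntropy_le_neg_sum_mul_logb hp X Y (fun a b => (hQ a b).le)
    (fun ω _ => hQ (X ω) (Y ω)) hsum).trans_eq ?_
  rw [prob, Finset.sum_mul, ← hp1, ← Finset.sum_neg_distrib, ← Finset.sum_add_distrib]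
  refine Finset.sum_congr rfl fun ω _ => ?_
  by_cases h : g (Y ω) = X ω
  · simp [h, Real.logb_inv]
  · simp only [h, if_false, Set.mem_ofPred_eq, ne_eq, not_false_eq_true, if_true]
    rw [Real.logb_inv, Real.logb_mul two_ne_zero (by positivity), Real.logb_self_eq_one one_lt_two]
    ring

end Entropy

section MassCondEntropy

variable {Ω A B J : Type*} [Fintype Ω] [Fintype A] [Fintype B] [Fintype J]

/-- The summand `-x log₂ x` of the entropy, as a continuous function on the real line. -/
def negMulLog2 (x : ℝ) : ℝ := Real.negMulLog x / Real.log 2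

theorem negMulLog2_eq (x : ℝ) : negMulLog2 x = -(x * Real.logb 2 x) := by
  rw [negMulLog2, Real.negMulLog, Real.logb]
  ring

theorem negMulLog2_mul (x y : ℝ) :
    negMulLog2 (x * y) = y * negMulLog2 x + x * negMulLog2 y := by
  simp only [negMulLog2, Real.negMulLog_mul]
  ring

@[fun_prop]
theorem continuous_negMulLog2 : Continuous negMulLog2 :=
  Real.continuous_negMulLog.div_const _

theorem entropy_eq_sum_negMulLog2 (p : Ω → ℝ) (X : Ω → A) :
    entropy p X = ∑ a, negMulLog2 (law p X a) := by
  simp [entropy, negMulLog2_eq]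

/-- The conditional entropy of the first coordinate given the second one, as a function of a
joint measure `ρ` that need not be normalized; this makes it homogeneous. -/
def massCondEntropy (ρ : A → B → ℝ) : ℝ :=
  ∑ b, (∑ a, negMulLog2 (ρ a b) - negMulLog2 (∑ a, ρ a b))

theorem condEntropy_eq_massCondEntropy {p : Ω → ℝ} (hp : ∀ ω, 0 ≤ p ω) (X : Ω → A) (Y : Ω → B) :
    condEntropy p X Y = massCondEntropy fun a b => law p (fun ω => (X ω, Y ω)) (a, b) := by
  rw [condEntropy_eq_sub hp, entropy_eq_sum_negMulLog2, entropy_eq_sum_negMulLog2, massCondEntropy,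
    Finset.sum_sub_distrib, Fintype.sum_prod_type_right]
  simp_rw [sum_law_pair_left]

theorem massCondEntropy_mul (c : ℝ) (ρ : A → B → ℝ) :
    massCondEntropy (fun a b => c * ρ a b) = c * massCondEntropy ρ := by
  simp only [massCondEntropy, negMulLog2_mul, ← Finset.mul_sum, ← Finset.sum_mul,
    Finset.sum_add_distrib, add_sub_add_left_eq_sub, ← mul_sub]

@[fun_prop]
theorem continuous_massCondEntropy : Continuous (massCondEntropy : (A → B → ℝ) → ℝ) := by
  unfold massCondEntropy
  fun_prop

theorem massCondEntropy_prod_right (ρ : A → J × B → ℝ) :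
    massCondEntropy ρ = ∑ j, massCondEntropy fun a b => ρ a (j, b) := by
  simp only [massCondEntropy, Fintype.sum_prod_type]

/-- An averaging index is a further conditioning variable, and conditioning reduces entropy. -/
theorem sum_massCondEntropy_le {ρ : J → A → B → ℝ} (hρ : ∀ j a b, 0 ≤ ρ j a b) :
    ∑ j, massCondEntropy (ρ j) ≤ massCondEntropy fun a b => ∑ j, ρ j a b := by
  classical
  set p : J × A × B → ℝ := fun z => ρ z.1 z.2.1 z.2.2
  have hp (z : J × A × B) : 0 ≤ p z := hρ _ _ _
  have hjoint (a : A) (j : J) (b : B) :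
      law p (fun z => (z.2.1, z.1, z.2.2)) (a, j, b) = ρ j a b := by
    rw [law_eq_sum, Finset.sum_eq_single (j, a, b)] <;> aesop
  have hmarginal (a : A) (b : B) : law p (fun z => (z.2.1, z.2.2)) (a, b) = ∑ j, ρ j a b := by
    rw [law_eq_sum, Fintype.sum_prod_type]
    refine Finset.sum_congr rfl fun j _ => ?_
    rw [Finset.sum_eq_single (a, b)] <;> aesop
  have h := condEntropy_pair_right_le hp (fun z => z.2.1) (fun z => z.1) (fun z => z.2.2)
  rw [condEntropy_eq_massCondEntropy hp, condEntropy_eq_massCondEntropy hp,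
    massCondEntropy_prod_right] at h
  simpa only [hjoint, hmarginal] using h

end MassCondEntropy

section ConvexHull

theorem sum_mem_of_inv_smul_mem {J G : Type*} [Fintype J] [AddCommGroup G] [Module ℝ G]
    {K : Set G} (hK : Convex ℝ K) {l : J → ℝ} {v : J → G} (hl : ∀ j, 0 ≤ l j)
    (hl1 : ∑ j, l j = 1) (hv : ∀ j, 0 < l j → (l j)⁻¹ • v j ∈ K)
    (hv0 : ∀ j, l j = 0 → v j = 0) : ∑ j, v j ∈ K := by
  have hv' (j : J) : l j • (l j)⁻¹ • v j = v j := by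
    rcases eq_or_ne (l j) 0 with h | h
    · simp [h, hv0 j h]
    · exact smul_inv_smul₀ h (v j)
  have h := hK.finsum_mem hl ((finsum_eq_sum_of_fintype l).trans hl1)
    fun j hj => hv j ((hl j).lt_of_ne' hj)
  simpa only [finsum_eq_sum_of_fintype, hv'] using h

variable {G : Type*} [NormedAddCommGroup G] [NormedSpace ℝ G] {K : Set G}

/-- By Carathéodory's theorem, combinations of boundedly many points suffice. -/
theorem isCompact_convexHull_of_isCompact [FiniteDimensional ℝ G] (hK : IsCompact K) :
    IsCompact (convexHull ℝ K) := by
  set combos : ℕ → Set G := fun m =>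
    (fun z : (Fin m → ℝ) × (Fin m → G) => ∑ i, z.1 i • z.2 i) ''
      (stdSimplex ℝ (Fin m) ×ˢ Set.univ.pi fun _ => K)
  have hcombos (m : ℕ) : IsCompact (combos m) :=
    ((isCompact_stdSimplex ℝ (Fin m)).prod (isCompact_univ_pi fun _ => hK)).image (by fun_prop)
  have hunion : convexHull ℝ K = ⋃ m : Fin (Module.finrank ℝ G + 2), combos m := by
    refine Set.Subset.antisymm (fun x hx => ?_) (Set.iUnion_subset fun m => ?_)
    · obtain ⟨κ, _, z, w, hz, hind, hw, hw1, rfl⟩ := eq_pos_convex_span_of_mem_convexHull hx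
      have hcard : Fintype.card κ ≤ Module.finrank ℝ G + 1 :=
        hind.card_le_finrank_succ.trans (Nat.succ_le_succ (Submodule.finrank_le _))
      set e := (Fintype.equivFin κ).symm
      refine Set.mem_iUnion.2 ⟨⟨Fintype.card κ, Nat.lt_succ_of_le hcard⟩, (w ∘ e, z ∘ e),
        ⟨⟨fun i => (hw (e i)).le, ?_⟩, fun i _ => hz ⟨e i, rfl⟩⟩, ?_⟩
      · exact (e.sum_comp w).trans hw1
      · exact e.sum_comp fun k => w k • z k
    · rintro _ ⟨⟨w, z⟩, ⟨hw, hz⟩, rfl⟩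
      exact (convex_convexHull ℝ K).sum_mem (fun i _ => hw.1 i) hw.2
        fun i _ => subset_convexHull ℝ K (hz i (Set.mem_univ i))
  rw [hunion]
  exact isCompact_iUnion fun m => hcombos m

theorem exists_fin_of_mem_convexHull {x : G} (hx : x ∈ convexHull ℝ K) :
    ∃ (m : ℕ) (w : Fin m → ℝ) (z : Fin m → G),
      (∀ i, 0 ≤ w i) ∧ (∀ i, z i ∈ K) ∧ ∑ i, w i • z i = x := by
  obtain ⟨κ, _, w, z, hw, -, hz, rfl⟩ := mem_convexHull_iff_exists_fintype.1 hx
  set e := (Fintype.equivFin κ).symm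
  exact ⟨Fintype.card κ, w ∘ e, z ∘ e, fun i => hw (e i), fun i => hz (e i),
    e.sum_comp fun k => w k • z k⟩

end ConvexHull

section SplitHull

variable {ι F : Type*} [Fintype ι] [NormedAddCommGroup F] [NormedSpace ℝ F]

/-- The convex hull of the graph of `f` over the probability simplex. -/
def graphHull (f : (ι → ℝ) → F) : Set ((ι → ℝ) × F) :=
  convexHull ℝ ((fun q => (q, f q)) '' stdSimplex ℝ ι)

/-- Two points of the graph hull over a common base point, together with the graph point. -/
def graphPairs (f : (ι → ℝ) → F) : Set ((ι → ℝ) × F × F × F) :=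
  {z | z.2.1 = f z.1 ∧ (z.1, z.2.2.1) ∈ graphHull f ∧ (z.1, z.2.2.2) ∈ graphHull f}

/-- The pmfs together with the averages of `f` over one of their decompositions and over two
refinements of this decomposition. -/
def splitHull (f : (ι → ℝ) → F) : Set ((ι → ℝ) × F × F × F) :=
  convexHull ℝ (graphPairs f)

variable {f : (ι → ℝ) → F}

theorem isCompact_splitHull [FiniteDimensional ℝ F] (hf : Continuous f) :
    IsCompact (splitHull f) := by
  have hgraph : IsCompact (graphHull f) :=
    isCompact_convexHull_of_isCompact ((isCompact_stdSimplex ℝ ι).image (by fun_prop))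
  have hpairs : graphPairs f =
      (fun z : ((ι → ℝ) × F) × (ι → ℝ) × F => (z.1.1, f z.1.1, z.1.2, z.2.2)) ''
        ((graphHull f ×ˢ graphHull f) ∩ {z | z.1.1 = z.2.1}) := by
    ext ⟨q, x, y, z⟩
    constructor
    · rintro ⟨hx, hy, hz⟩
      exact ⟨((q, y), (q, z)), ⟨⟨hy, hz⟩, rfl⟩, by rw [show x = f q from hx]⟩
    · rintro ⟨⟨⟨q₁, y₁⟩, q₂, z₂⟩, ⟨⟨hy, hz⟩, hq⟩, h⟩
      obtain rfl : q₁ = q₂ := hq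
      cases h
      exact ⟨rfl, hy, hz⟩
  refine isCompact_convexHull_of_isCompact ?_
  rw [hpairs]
  exact ((hgraph.prod hgraph).inter_right (isClosed_eq (by fun_prop) (by fun_prop))).image
    (by fun_prop)

/-- `r` is a decomposition of the measure `t` into finitely many nonnegative measures. -/
structure IsDecomposition {U : Type*} [Fintype U] (r : U → ι → ℝ) (t : ι → ℝ) : Prop where
  nonneg : ∀ u i, 0 ≤ r u i
  sum_eq : ∑ u, r u = t

namespace IsDecomposition

variable {ι U : Type*} [Fintype U] {r : U → ι → ℝ} {t : ι → ℝ}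

theorem sum_apply (h : IsDecomposition r t) (i : ι) : ∑ u, r u i = t i := by
  rw [← h.sum_eq, Finset.sum_apply]

theorem target_nonneg (h : IsDecomposition r t) (i : ι) : 0 ≤ t i := by
  rw [← h.sum_apply i]
  exact Finset.sum_nonneg fun u _ => h.nonneg u i

theorem apply_le (h : IsDecomposition r t) (u : U) (i : ι) : r u i ≤ t i := by
  rw [← h.sum_apply i]
  exact Finset.single_le_sum (fun u' _ => h.nonneg u' i) (Finset.mem_univ u)

theorem smul (h : IsDecomposition r t) {c : ℝ} (hc : 0 ≤ c) :
    IsDecomposition (fun u => c • r u) (c • t) where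
  nonneg u i := mul_nonneg hc (h.nonneg u i)
  sum_eq := by rw [← Finset.smul_sum, h.sum_eq]

theorem eq_zero (h : IsDecomposition r 0) (u : U) : r u = 0 :=
  funext fun i => le_antisymm (h.apply_le u i) (h.nonneg u i)

end IsDecomposition

theorem inv_sum_smul_mem_stdSimplex {q : ι → ℝ} (hq : ∀ i, 0 ≤ q i) (h : 0 < ∑ i, q i) :
    (∑ i, q i)⁻¹ • q ∈ stdSimplex ℝ ι := by
  refine ⟨fun i => mul_nonneg (inv_nonneg.2 h.le) (hq i), ?_⟩
  simp only [Pi.smul_apply, smul_eq_mul, ← Finset.mul_sum, inv_mul_cancel₀ h.ne']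

theorem eq_zero_of_sum_eq_zero {q : ι → ℝ} (hq : ∀ i, 0 ≤ q i) (h : ∑ i, q i = 0) : q = 0 :=
  (Fintype.sum_eq_zero_iff_of_nonneg hq).1 h

theorem mk_mem_graphHull (hf : ∀ (c : ℝ) q, f (c • q) = c • f q) {U : Type*} [Fintype U]
    {r : U → ι → ℝ} {t : ι → ℝ} (hr : IsDecomposition r t) (ht : t ∈ stdSimplex ℝ ι) :
    (t, ∑ u, f (r u)) ∈ graphHull f := by
  have hsum : (t, ∑ u, f (r u)) = ∑ u, (r u, f (r u)) := by
    simp [Prod.ext_iff, Prod.fst_sum, Prod.snd_sum, hr.sum_eq]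
  rw [hsum]
  refine sum_mem_of_inv_smul_mem (convex_convexHull ℝ _) (l := fun u => ∑ i, r u i)
    (fun u => Finset.sum_nonneg fun i _ => hr.nonneg u i) ?_ (fun u hu => ?_) (fun u hu => ?_)
  · rw [Finset.sum_comm, ← ht.2, ← hr.sum_eq]
    simp only [Finset.sum_apply]
  · exact subset_convexHull ℝ _ ⟨_, inv_sum_smul_mem_stdSimplex (hr.nonneg u) hu, by simp [hf]⟩
  · have hf0 : f 0 = 0 := by simpa using hf 0 0
    rw [eq_zero_of_sum_eq_zero (hr.nonneg u) hu, hf0, Prod.mk_zero_zero]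

theorem inv_sum_smul_mem_graphPairs (hf : ∀ (c : ℝ) q, f (c • q) = c • f q) {U V : Type*}
    [Fintype U] [Fintype V] {r : U → ι → ℝ} {r' : V → ι → ℝ} {t : ι → ℝ}
    (hr : IsDecomposition r t) (hr' : IsDecomposition r' t) (ht : 0 < ∑ i, t i) :
    (∑ i, t i)⁻¹ • (t, f t, ∑ u, f (r u), ∑ v, f (r' v)) ∈ graphPairs f := by
  have hc : 0 ≤ (∑ i, t i)⁻¹ := inv_nonneg.2 ht.le
  have htc := inv_sum_smul_mem_stdSimplex hr.target_nonneg ht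
  refine ⟨(hf _ t).symm, ?_, ?_⟩
  · simpa [hf, ← Finset.smul_sum] using mk_mem_graphHull hf (hr.smul hc) htc
  · simpa [hf, ← Finset.smul_sum] using mk_mem_graphHull hf (hr'.smul hc) htc

theorem sum_mem_splitHull (hf : ∀ (c : ℝ) q, f (c • q) = c • f q) {J U V : Type*} [Fintype J]
    [Fintype U] [Fintype V] {t : J → ι → ℝ} {r : J → U → ι → ℝ} {r' : J → V → ι → ℝ}
    (hr : ∀ j, IsDecomposition (r j) (t j)) (hr' : ∀ j, IsDecomposition (r' j) (t j))
    (ht : ∑ j, ∑ i, t j i = 1) :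
    ∑ j, (t j, f (t j), ∑ u, f (r j u), ∑ v, f (r' j v)) ∈ splitHull f := by
  refine sum_mem_of_inv_smul_mem (convex_convexHull ℝ _)
    (fun j => Finset.sum_nonneg fun i _ => (hr j).target_nonneg i) ht
    (fun j hj => subset_convexHull ℝ _ (inv_sum_smul_mem_graphPairs hf (hr j) (hr' j) hj))
    (fun j hj => ?_)
  have h0 : t j = 0 := eq_zero_of_sum_eq_zero (hr j).target_nonneg hj
  have hf0 : f 0 = 0 := by simpa using hf 0 0
  simp [(h0 ▸ hr j).eq_zero, (h0 ▸ hr' j).eq_zero, h0, hf0]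

theorem exists_isDecomposition_of_mem_graphHull (hf : ∀ (c : ℝ) q, f (c • q) = c • f q)
    {z : (ι → ℝ) × F} (hz : z ∈ graphHull f) :
    ∃ (m : ℕ) (r : Fin m → ι → ℝ), IsDecomposition r z.1 ∧ ∑ j, f (r j) = z.2 := by
  obtain ⟨m, w, y, hw, hy, rfl⟩ := exists_fin_of_mem_convexHull hz
  choose q hq hqy using hy
  refine ⟨m, fun j => w j • q j, ⟨fun j i => mul_nonneg (hw j) ((hq j).1 i), ?_⟩, ?_⟩
  · simp [Prod.fst_sum, ← hqy]
  · simp [Prod.snd_sum, ← hqy, hf]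

/-- The finite families `r j`, of different lengths, are extended by zero to a common length. -/
def padFamily {a : ℕ} {m : Fin a → ℕ} {G : Type*} [Zero G] (r : (j : Fin a) → Fin (m j) → G)
    (j : Fin a) (k : Fin (∑ j, m j)) : G :=
  if (finSigmaFinEquiv.symm k).1 = j then r _ (finSigmaFinEquiv.symm k).2 else 0

theorem sum_map_padFamily {a : ℕ} {m : Fin a → ℕ} {G H : Type*} [Zero G] [AddCommMonoid H]
    (r : (j : Fin a) → Fin (m j) → G) {g : G → H} (hg : g 0 = 0) (j : Fin a) :
    ∑ k, g (padFamily r j k) = ∑ u, g (r j u) := by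
  refine (finSigmaFinEquiv.symm.sum_comp fun p => g (if p.1 = j then r p.1 p.2 else 0)).trans ?_
  rw [Fintype.sum_sigma, Finset.sum_eq_single j] <;> simp +contextual [hg]

theorem IsDecomposition.padFamily {ι : Type*} {a : ℕ} {m : Fin a → ℕ}
    {r : (j : Fin a) → Fin (m j) → ι → ℝ} {t : Fin a → ι → ℝ}
    (hr : ∀ j, IsDecomposition (r j) (t j)) (j : Fin a) :
    IsDecomposition (padFamily r j) (t j) where
  nonneg k i := by
    unfold StateMasking.padFamily
    split_ifs
    exacts [(hr _).nonneg _ i, le_rfl]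
  sum_eq := (sum_map_padFamily r (g := id) rfl j).trans (hr j).sum_eq

theorem exists_isDecomposition_of_mem_splitHull (hf : ∀ (c : ℝ) q, f (c • q) = c • f q)
    {z : (ι → ℝ) × F × F × F} (hz : z ∈ splitHull f) :
    ∃ (a b c : ℕ) (t : Fin a → ι → ℝ) (r : Fin a → Fin b → ι → ℝ) (r' : Fin a → Fin c → ι → ℝ),
      (∀ j, IsDecomposition (r j) (t j)) ∧ (∀ j, IsDecomposition (r' j) (t j)) ∧
      ∑ j, (t j, f (t j), ∑ u, f (r j u), ∑ v, f (r' j v)) = z := by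
  obtain ⟨a, w, y, hw, hy, rfl⟩ := exists_fin_of_mem_convexHull hz
  choose hy₁ hy₂ hy₃ using hy
  choose m r hr hrf using fun j => exists_isDecomposition_of_mem_graphHull hf (hy₂ j)
  choose m' r' hr' hrf' using fun j => exists_isDecomposition_of_mem_graphHull hf (hy₃ j)
  have hf0 : f 0 = 0 := by simpa using hf 0 0
  refine ⟨a, _, _, fun j => w j • (y j).1, padFamily fun j u => w j • r j u,
    padFamily fun j v => w j • r' j v, IsDecomposition.padFamily fun j => (hr j).smul (hw j),
    IsDecomposition.padFamily fun j => (hr' j).smul (hw j), Finset.sum_congr rfl fun j _ => ?_⟩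
  rw [sum_map_padFamily _ hf0, sum_map_padFamily _ hf0]
  simp only [hf, ← Finset.smul_sum, hrf, hrf', ← hy₁]
  rfl

end SplitHull

section Kernel

variable {S X Y B J : Type*}

open Classical in
/-- The transition function of the component `π` of the channel output. -/
def marginalKernel [Fintype B] (π : B → Y) (τ : X → S → B → ℝ) (x : X) (s : S) (y : Y) : ℝ :=
  ∑ b, if π b = y then τ x s b else 0

theorem marginalKernel_nonneg [Fintype B] (π : B → Y) {τ : X → S → B → ℝ}
    (hτ : ∀ x s b, 0 ≤ τ x s b) (x : X) (s : S) (y : Y) : 0 ≤ marginalKernel π τ x s y :=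
  Finset.sum_nonneg fun b _ => by split_ifs <;> simp [hτ]

theorem sum_marginalKernel [Fintype B] [Fintype Y] (π : B → Y) (τ : X → S → B → ℝ) (x : X)
    (s : S) : ∑ y, marginalKernel π τ x s y = ∑ b, τ x s b := by
  classical
  simp_rw [marginalKernel]
  rw [Finset.sum_comm]
  simp

variable [Fintype S] [Fintype X] [Fintype Y]

/-- `H(Y | S)` for the state-input measure `q`, which need not be normalized. -/
def outputEntropy (T : X → S → Y → ℝ) (q : S × X → ℝ) : ℝ :=
  massCondEntropy fun y s => ∑ x, q (s, x) * T x s y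

/-- `H(S | Y)` for the state-input measure `q`, which need not be normalized. -/
def equivocation (T : X → S → Y → ℝ) (q : S × X → ℝ) : ℝ :=
  massCondEntropy fun s y => ∑ x, q (s, x) * T x s y

/-- `H(Y | X, S)` for the state-input measure `q`, which need not be normalized. -/
def noiseEntropy (T : X → S → Y → ℝ) (q : S × X → ℝ) : ℝ :=
  ∑ z, q z * ∑ y, negMulLog2 (T z.2 z.1 y)

variable (T : X → S → Y → ℝ)

theorem outputEntropy_smul (c : ℝ) (q : S × X → ℝ) :
    outputEntropy T (c • q) = c * outputEntropy T q := by
  simp only [outputEntropy, ← massCondEntropy_mul, Pi.smul_apply, smul_eq_mul, mul_assoc,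
    Finset.mul_sum]

theorem equivocation_smul (c : ℝ) (q : S × X → ℝ) :
    equivocation T (c • q) = c * equivocation T q := by
  simp only [equivocation, ← massCondEntropy_mul, Pi.smul_apply, smul_eq_mul, mul_assoc,
    Finset.mul_sum]

@[fun_prop]
theorem continuous_outputEntropy : Continuous (outputEntropy T) :=
  continuous_massCondEntropy.comp (by fun_prop)

@[fun_prop]
theorem continuous_equivocation : Continuous (equivocation T) :=
  continuous_massCondEntropy.comp (by fun_prop)

@[fun_prop]
theorem continuous_noiseEntropy : Continuous (noiseEntropy T) := by
  unfold noiseEntropy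
  fun_prop

variable {T}

theorem sum_outputEntropy_le [Fintype J] (hT : ∀ x s y, 0 ≤ T x s y) {q : J → S × X → ℝ}
    (hq : ∀ j z, 0 ≤ q j z) : ∑ j, outputEntropy T (q j) ≤ outputEntropy T (∑ j, q j) := by
  refine (sum_massCondEntropy_le fun j y s => Finset.sum_nonneg fun x _ =>
    mul_nonneg (hq j _) (hT x s y)).trans_eq ?_
  simp only [outputEntropy, Finset.sum_apply, Finset.sum_mul, Finset.sum_comm (γ := X)]

theorem sum_equivocation_le [Fintype J] (hT : ∀ x s y, 0 ≤ T x s y) {q : J → S × X → ℝ}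
    (hq : ∀ j z, 0 ≤ q j z) : ∑ j, equivocation T (q j) ≤ equivocation T (∑ j, q j) := by
  refine (sum_massCondEntropy_le fun j s y => Finset.sum_nonneg fun x _ =>
    mul_nonneg (hq j _) (hT x s y)).trans_eq ?_
  simp only [equivocation, Finset.sum_apply, Finset.sum_mul, Finset.sum_comm (γ := X)]

theorem noiseEntropy_sum [Fintype J] (T : X → S → Y → ℝ) (q : J → S × X → ℝ) :
    noiseEntropy T (∑ j, q j) = ∑ j, noiseEntropy T (q j) := by
  simp only [noiseEntropy, Finset.sum_apply, Finset.sum_mul, Finset.sum_comm (γ := J)]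

theorem noiseEntropy_smul (c : ℝ) (q : S × X → ℝ) :
    noiseEntropy T (c • q) = c * noiseEntropy T q := by
  simp only [noiseEntropy, Pi.smul_apply, smul_eq_mul, mul_assoc, Finset.mul_sum]

end Kernel

section ChannelOutput

variable {Ω S X Y B Z Z' : Type*} [Fintype Ω] {p : Ω → ℝ} {τ : X → S → B → ℝ}
  {St : Ω → S} {In : Ω → X} {out : Ω → B} {Zv : Ω → Z}

/-- Under `p`, the output `out` is drawn from the kernel `τ` at the state `St` and the input `In`,
independently of `Zv`. -/
def IsChannelOutput (p : Ω → ℝ) (τ : X → S → B → ℝ) (St : Ω → S) (In : Ω → X) (out : Ω → B)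
    (Zv : Ω → Z) : Prop :=
  ∀ b z s x, law p (fun ω => (out ω, Zv ω, St ω, In ω)) (b, z, s, x) =
    law p (fun ω => (Zv ω, St ω, In ω)) (z, s, x) * τ x s b

theorem isChannelOutput_of_resampling [Fintype B] (up : Ω → B → Ω) (hτ : ∀ x s, ∑ b, τ x s b = 1)
    (hout : ∀ ω b, out (up ω b) = b) (hup : ∀ ω b, up (up ω b) (out ω) = ω)
    (hSt : ∀ ω b, St (up ω b) = St ω) (hIn : ∀ ω b, In (up ω b) = In ω)
    (hZv : ∀ ω b, Zv (up ω b) = Zv ω)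
    (hp : ∀ ω b, p ω * τ (In ω) (St ω) b = p (up ω b) * τ (In ω) (St ω) (out ω)) :
    IsChannelOutput p τ St In out Zv := by
  classical
  intro b z s x
  set C : Ω → Z × S × X := fun ω => (Zv ω, St ω, In ω)
  have hC (ω : Ω) (b : B) : C (up ω b) = C ω := by simp only [C, hZv, hSt, hIn]
  have hp' (ω : Ω) (b' : B) (hω : C ω = (z, s, x)) :
      p ω * τ x s b' = p (up ω b') * τ x s (out ω) := by
    obtain ⟨-, rfl, rfl⟩ := by simpa only [C, Prod.mk.injEq] using hω
    exact hp ω b'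
  have hinv : Function.Involutive fun z : Ω × B => (up z.1 z.2, out z.1) := fun z => by
    simp [hup, hout]
  calc law p (fun ω => (out ω, C ω)) (b, z, s, x)
      = ∑ ω, ∑ b', if out ω = b ∧ C ω = (z, s, x) then p ω * τ x s b' else 0 := by
        simp only [law_eq_sum, Finset.sum_ite_irrel, ← Finset.mul_sum, hτ, mul_one,
          Prod.mk.injEq, Finset.sum_const_zero]
    _ = ∑ ω, ∑ b', if b' = b ∧ C ω = (z, s, x) then p (up ω b') * τ x s (out ω) else 0 := by
        rw [← Fintype.sum_prod_type', ← Fintype.sum_prod_type', ← Equiv.sum_comp hinv.toPerm]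
        simp [hout, hC]
    _ = ∑ ω, ∑ b', if b' = b ∧ C ω = (z, s, x) then p ω * τ x s b' else 0 := by
        refine Finset.sum_congr rfl fun ω _ => Finset.sum_congr rfl fun b' _ => ?_
        split_ifs with hω
        exacts [(hp' ω b' hω.2).symm, rfl]
    _ = law p C (z, s, x) * τ x s b := by
        simp [law_eq_sum, ite_and, Finset.sum_mul]

namespace IsChannelOutput

theorem comp [Finite Z] (h : IsChannelOutput p τ St In out Zv) (f : Z → Z') :
    IsChannelOutput p τ St In out fun ω => f (Zv ω) := by
  classical
  cases nonempty_fintype Z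
  intro b z' s x
  calc law p (fun ω => (out ω, f (Zv ω), St ω, In ω)) (b, z', s, x)
      = law p (fun ω => (f (Zv ω), out ω, St ω, In ω)) (z', b, s, x) :=
        law_congr p fun ω => by simp only [Prod.mk.injEq]; tauto
    _ = ∑ z, if f z = z' then law p (fun ω => (out ω, Zv ω, St ω, In ω)) (b, z, s, x) else 0 := by
        rw [law_pair_comp_left p Zv (fun ω => (out ω, St ω, In ω)) f]
        refine Finset.sum_congr rfl fun z _ => ?_
        rw [law_congr p (Y := fun ω => (out ω, Zv ω, St ω, In ω)) (b := (b, z, s, x)) fun ω => by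
          simp only [Prod.mk.injEq]; tauto]
    _ = law p (fun ω => (f (Zv ω), St ω, In ω)) (z', s, x) * τ x s b := by
        simp only [h b _ s x, law_pair_comp_left p Zv (fun ω => (St ω, In ω)) f, Finset.sum_mul,
          ite_mul, zero_mul]

theorem marginal [Fintype B] (h : IsChannelOutput p τ St In out Zv) (π : B → Y) :
    IsChannelOutput p (marginalKernel π τ) St In (fun ω => π (out ω)) Zv := by
  classical
  intro y z s x
  rw [law_pair_comp_left p out (fun ω => (Zv ω, St ω, In ω)) π]
  simp only [h _ z s x, marginalKernel, Finset.mul_sum, mul_ite, mul_zero]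

theorem law_output_state [Fintype X] (h : IsChannelOutput p τ St In out Zv) (b : B) (z : Z)
    (s : S) : law p (fun ω => (out ω, Zv ω, St ω)) (b, z, s) =
      ∑ x, law p (fun ω => (Zv ω, St ω, In ω)) (z, s, x) * τ x s b := by
  rw [← sum_law_pair_left p In]
  refine Finset.sum_congr rfl fun x _ => ?_
  rw [← h b z s x]
  exact law_congr p fun ω => by simp only [Prod.mk.injEq]; tauto

theorem law_output [Fintype X] [Finite Z] (h : IsChannelOutput p τ St In out Zv) (b : B)
    (s : S) : law p (fun ω => (out ω, St ω)) (b, s) =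
      ∑ x, law p (fun ω => (St ω, In ω)) (s, x) * τ x s b := by
  have hunit (x : X) : law p (fun ω => ((), St ω, In ω)) ((), s, x) =
      law p (fun ω => (St ω, In ω)) (s, x) := law_congr p (by simp)
  simp only [← hunit, ← (h.comp fun _ => ()).law_output_state b () s]
  exact law_congr p (by simp)

variable [Fintype S] [Fintype X] [Fintype B] (hp : ∀ ω, 0 ≤ p ω)
include hp

theorem condEntropy_eq_sum_outputEntropy [Fintype Z] (h : IsChannelOutput p τ St In out Zv) :
    condEntropy p out (fun ω => (Zv ω, St ω)) =
      ∑ z, outputEntropy τ fun w => law p (fun ω => (Zv ω, St ω, In ω)) (z, w) := by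
  rw [condEntropy_eq_massCondEntropy hp, massCondEntropy_prod_right]
  simp only [outputEntropy, h.law_output_state]

theorem condEntropy_state_input [Fintype Z] (h : IsChannelOutput p τ St In out Zv)
    (hτ : ∀ x s, ∑ b, τ x s b = 1) :
    condEntropy p out (fun ω => (Zv ω, St ω, In ω)) =
      noiseEntropy τ (law p fun ω => (St ω, In ω)) := by
  have h1 : negMulLog2 1 = 0 := by simp [negMulLog2]
  rw [condEntropy_eq_massCondEntropy hp, massCondEntropy]
  simp only [h _ _ _ _, ← Finset.mul_sum, ← Finset.sum_mul, hτ, negMulLog2_mul, h1,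
    Finset.sum_add_distrib, one_mul, mul_zero, add_zero, add_sub_cancel_left, noiseEntropy]
  rw [Fintype.sum_prod_type_right]
  refine Finset.sum_congr rfl fun w _ => ?_
  dsimp only
  rw [← Finset.sum_mul, sum_law_pair_left p Zv fun ω => (St ω, In ω)]

theorem condEntropy_state [Finite Z] (h : IsChannelOutput p τ St In out Zv) :
    condEntropy p out St = outputEntropy τ (law p fun ω => (St ω, In ω)) := by
  rw [condEntropy_eq_massCondEntropy hp, outputEntropy]
  simp only [h.law_output]

theorem condEntropy_of_output [Finite Z] (h : IsChannelOutput p τ St In out Zv) :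
    condEntropy p St out = equivocation τ (law p fun ω => (St ω, In ω)) := by
  rw [condEntropy_eq_massCondEntropy hp, equivocation]
  simp only [← h.law_output]
  congr! 3 with s b
  exact law_congr p (by simp [and_comm])

theorem condMutualInfo_eq_outputEntropy_sub [Fintype Z] (h : IsChannelOutput p τ St In out Zv) :
    condMutualInfo p Zv out St =
      outputEntropy τ (law p fun ω => (St ω, In ω)) - condEntropy p out fun ω => (Zv ω, St ω) := by
  rw [condMutualInfo_eq_condEntropy_sub hp, h.condEntropy_state hp]

theorem condMutualInfo_input [Finite Z] (h : IsChannelOutput p τ St In out Zv)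
    (hτ : ∀ x s, ∑ b, τ x s b = 1) {C : Ω → Z'} [Fintype Z']
    (hC : ∀ ω ω', C ω = C ω' ↔ Zv ω = Zv ω' ∧ St ω = St ω') :
    condMutualInfo p In out C =
      condEntropy p out C - noiseEntropy τ (law p fun ω => (St ω, In ω)) := by
  cases nonempty_fintype Z
  rw [condMutualInfo_eq_condEntropy_sub hp, ← h.condEntropy_state_input hp hτ]
  congr 1
  exact condEntropy_congr_right p out fun ω ω' => by simp only [Prod.mk.injEq, hC]; tauto

theorem mutualInfo_state [Finite Z] (h : IsChannelOutput p τ St In out Zv) :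
    mutualInfo p St out = entropy p St - equivocation τ (law p fun ω => (St ω, In ω)) := by
  rw [mutualInfo, h.condEntropy_of_output hp]

end IsChannelOutput

end ChannelOutput

section LetterPoint

variable {Ω S X Y₁ Y₂ W U V : Type*} [Fintype Ω] [Fintype S] [Fintype Y₁] [Fintype Y₂]
  [Fintype W] [Fintype U] [Fintype V]

namespace Channel

variable (ch : Channel S X Y₁ Y₂)

/-- `P_{Y₁ | X S}` -/
def trans₁ : X → S → Y₁ → ℝ := marginalKernel Prod.fst ch.trans

/-- `P_{Y₂ | X S}` -/
def trans₂ : X → S → Y₂ → ℝ := marginalKernel Prod.snd ch.trans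

theorem sum_trans₁ (x : X) (s : S) : ∑ y, ch.trans₁ x s y = 1 :=
  (sum_marginalKernel _ _ x s).trans (ch.trans_mem x s).2

theorem sum_trans₂ (x : X) (s : S) : ∑ y, ch.trans₂ x s y = 1 :=
  (sum_marginalKernel _ _ x s).trans (ch.trans_mem x s).2

variable [Fintype X]

/-- `(H(Y₁ | S), H(Y₂ | S))` for the state-input measure `q`, which need not be normalized. -/
def outputEntropies (q : S × X → ℝ) : ℝ × ℝ :=
  (outputEntropy ch.trans₁ q, outputEntropy ch.trans₂ q)

theorem outputEntropies_smul (c : ℝ) (q : S × X → ℝ) :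
    ch.outputEntropies (c • q) = c • ch.outputEntropies q := by
  simp [outputEntropies, outputEntropy_smul]

theorem continuous_outputEntropies : Continuous ch.outputEntropies := by
  unfold outputEntropies
  fun_prop

end Channel

/-- `(H(Y₁ | C), H(Y₂ | C))` for the pair of outputs `(Y₁, Y₂)`. -/
def condEntropies (p : Ω → ℝ) (out : Ω → Y₁ × Y₂) {C : Type*} [Fintype C] (Cv : Ω → C) : ℝ × ℝ :=
  (condEntropy p (fun ω => (out ω).1) Cv, condEntropy p (fun ω => (out ω).2) Cv)

theorem condEntropies_congr (p : Ω → ℝ) (out : Ω → Y₁ × Y₂) {Wv : Ω → W} {Uv : Ω → U}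
    (h : ∀ ω ω', Wv ω = Wv ω' ↔ Uv ω = Uv ω') :
    condEntropies p out Wv = condEntropies p out Uv :=
  Prod.ext (condEntropy_congr_right p _ h) (condEntropy_congr_right p _ h)

/-- The data entering the single-letter bounds: the joint pmf of the state and the input, and the
entropies of the two outputs given `(W, S)`, `(U, W, S)` and `(V, W, S)`. -/
def letterPoint (p : Ω → ℝ) (St : Ω → S) (In : Ω → X) (out : Ω → Y₁ × Y₂) (Wv : Ω → W)
    (Uv : Ω → U) (Vv : Ω → V) : (S × X → ℝ) × (ℝ × ℝ) × (ℝ × ℝ) × (ℝ × ℝ) :=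
  (law p fun ω => (St ω, In ω), condEntropies p out fun ω => (Wv ω, St ω),
    condEntropies p out fun ω => (Uv ω, Wv ω, St ω),
    condEntropies p out fun ω => (Vv ω, Wv ω, St ω))

variable [Fintype X] {p : Ω → ℝ} {ch : Channel S X Y₁ Y₂} {St : Ω → S} {In : Ω → X}
  {out : Ω → Y₁ × Y₂} {Wv : Ω → W} {Uv : Ω → U} {Vv : Ω → V}

theorem isDecomposition_law {A I : Type*} (hp : ∀ ω, 0 ≤ p ω) (Uv : Ω → U) (Av : Ω → A)
    (Iv : Ω → I) (a : A) :
    IsDecomposition (fun u i => law p (fun ω => (Uv ω, Av ω, Iv ω)) (u, a, i))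
      fun i => law p (fun ω => (Av ω, Iv ω)) (a, i) where
  nonneg u i := law_nonneg hp _ _
  sum_eq := funext fun i => by
    rw [Finset.sum_apply, sum_law_pair_left p Uv fun ω => (Av ω, Iv ω)]

namespace IsChannelOutput

theorem condEntropies_eq_sum (hp : ∀ ω, 0 ≤ p ω) (h : IsChannelOutput p ch.trans St In out Wv) :
    condEntropies p out (fun ω => (Wv ω, St ω)) =
      ∑ w, ch.outputEntropies fun i => law p (fun ω => (Wv ω, St ω, In ω)) (w, i) := by
  ext
  · rw [Prod.fst_sum]
    exact (h.marginal Prod.fst).condEntropy_eq_sum_outputEntropy hp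
  · rw [Prod.snd_sum]
    exact (h.marginal Prod.snd).condEntropy_eq_sum_outputEntropy hp

theorem condEntropies_pair_eq_sum (hp : ∀ ω, 0 ≤ p ω)
    (h : IsChannelOutput p ch.trans St In out fun ω => (Uv ω, Wv ω)) :
    condEntropies p out (fun ω => (Uv ω, Wv ω, St ω)) =
      ∑ w, ∑ u, ch.outputEntropies fun i =>
        law p (fun ω => (Uv ω, Wv ω, St ω, In ω)) (u, w, i) := by
  have hassoc : condEntropies p out (fun ω => (Uv ω, Wv ω, St ω)) =
      condEntropies p out fun ω => ((Uv ω, Wv ω), St ω) :=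
    condEntropies_congr p out (by simp [and_assoc])
  rw [hassoc, h.condEntropies_eq_sum hp, Fintype.sum_prod_type_right]
  congr! 5 with w _ u _ i
  exact law_congr p (by simp [and_assoc])

theorem letterPoint_eq_sum (hp : ∀ ω, 0 ≤ p ω)
    (h : IsChannelOutput p ch.trans St In out fun ω => (Wv ω, Uv ω, Vv ω)) :
    letterPoint p St In out Wv Uv Vv = ∑ w,
      ((fun i => law p (fun ω => (Wv ω, St ω, In ω)) (w, i)),
        ch.outputEntropies (fun i => law p (fun ω => (Wv ω, St ω, In ω)) (w, i)),
        ∑ u, ch.outputEntropies (fun i => law p (fun ω => (Uv ω, Wv ω, St ω, In ω)) (u, w, i)),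
        ∑ v, ch.outputEntropies
          fun i => law p (fun ω => (Vv ω, Wv ω, St ω, In ω)) (v, w, i)) := by
  rw [letterPoint, (h.comp fun z => z.1).condEntropies_eq_sum hp,
    (h.comp fun z => (z.2.1, z.1)).condEntropies_pair_eq_sum hp,
    (h.comp fun z => (z.2.2, z.1)).condEntropies_pair_eq_sum hp]
  refine Prod.ext (funext fun i => ?_) (Prod.ext ?_ (Prod.ext ?_ ?_)) <;>
    simp only [Prod.fst_sum, Prod.snd_sum]
  rw [Finset.sum_apply, sum_law_pair_left p Wv fun ω => (St ω, In ω)]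

theorem letterPoint_mem_splitHull (hp : p ∈ stdSimplex ℝ Ω)
    (h : IsChannelOutput p ch.trans St In out fun ω => (Wv ω, Uv ω, Vv ω)) :
    letterPoint p St In out Wv Uv Vv ∈ splitHull ch.outputEntropies := by
  rw [h.letterPoint_eq_sum hp.1]
  refine sum_mem_splitHull ch.outputEntropies_smul
    (isDecomposition_law hp.1 Uv Wv fun ω => (St ω, In ω))
    (isDecomposition_law hp.1 Vv Wv fun ω => (St ω, In ω)) ?_
  rw [← Fintype.sum_prod_type', sum_law p fun ω => (Wv ω, St ω, In ω), hp.2]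

end IsChannelOutput

end LetterPoint

section SingleLetter

variable {S X Y₁ Y₂ : Type*} [Fintype S] [Fintype X] [Fintype Y₁] [Fintype Y₂]

/-- `H(S)` -/
def Channel.stateEntropy (ch : Channel S X Y₁ Y₂) : ℝ := ∑ s, negMulLog2 (ch.stateP s)

/-- The single-letter rate bounds with slack `δ`. Here `z = (q, h, a, b)` has the form of a
`letterPoint`: `q` is the joint mass of the state and the input, which need not be normalized, and
`h`, `a`, `b` are the pairs of output entropies given `(W, S)`, `(U, W, S)` and `(V, W, S)`. -/
def RateBounds (ch : Channel S X Y₁ Y₂) (R₀ R₁ R₂ : ℝ)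
    (z : (S × X → ℝ) × (ℝ × ℝ) × (ℝ × ℝ) × (ℝ × ℝ)) (δ : ℝ) : Prop :=
  let q := z.1
  let h := z.2.1
  let a := z.2.2.1
  let b := z.2.2.2
  let I₀ := min (outputEntropy ch.trans₁ q - h.1) (outputEntropy ch.trans₂ q - h.2)
  R₀ ≤ I₀ + δ ∧
  R₀ + R₁ ≤ I₀ + (h.1 - a.1) + δ ∧
  R₀ + R₂ ≤ I₀ + (h.2 - b.2) + δ ∧
  R₀ + R₁ + R₂ ≤ I₀ + (h.1 - a.1) + (a.2 - noiseEntropy ch.trans₂ q) + δ ∧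
  R₀ + R₁ + R₂ ≤ I₀ + (b.1 - noiseEntropy ch.trans₁ q) + (h.2 - b.2) + δ

theorem RateBounds.smul {ch : Channel S X Y₁ Y₂} {R₀ R₁ R₂ δ : ℝ}
    {z : (S × X → ℝ) × (ℝ × ℝ) × (ℝ × ℝ) × (ℝ × ℝ)} (h : RateBounds ch R₀ R₁ R₂ z δ) {c : ℝ}
    (hc : 0 ≤ c) : RateBounds ch (c * R₀) (c * R₁) (c * R₂) (c • z) (c * δ) := by
  obtain ⟨h₀, h₀₁, h₀₂, h₁, h₂⟩ := h
  simp only [RateBounds, Prod.smul_fst, Prod.smul_snd, smul_eq_mul, outputEntropy_smul,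
    noiseEntropy_smul, ← mul_sub, ← mul_min_of_nonneg _ _ hc, ← mul_add]
  exact ⟨mul_le_mul_of_nonneg_left h₀ hc, mul_le_mul_of_nonneg_left h₀₁ hc,
    mul_le_mul_of_nonneg_left h₀₂ hc, mul_le_mul_of_nonneg_left h₁ hc,
    mul_le_mul_of_nonneg_left h₂ hc⟩

/-- The single-letter conditions on rates and leakages with slack `δ`, at a point `z` of the form of
a `letterPoint`. -/
def SingleLetterBounds (ch : Channel S X Y₁ Y₂) (R₀ R₁ R₂ E₁ E₂ : ℝ)
    (z : (S × X → ℝ) × (ℝ × ℝ) × (ℝ × ℝ) × (ℝ × ℝ)) (δ : ℝ) : Prop :=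
  (∀ s, ∑ x, z.1 (s, x) = ch.stateP s) ∧
  RateBounds ch R₀ R₁ R₂ z δ ∧
  ch.stateEntropy - equivocation ch.trans₁ z.1 ≤ E₁ + δ ∧
  ch.stateEntropy - equivocation ch.trans₂ z.1 ≤ E₂ + δ

variable (ch : Channel S X Y₁ Y₂) (R₀ R₁ R₂ E₁ E₂ : ℝ)

theorem isClosed_rateBounds :
    IsClosed {z : _ × ℝ | RateBounds ch R₀ R₁ R₂ z.1 z.2} := by
  unfold RateBounds
  simp only [Set.ofPred_and]
  iterate 4 refine (isClosed_le (by fun_prop) (by fun_prop)).inter ?_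
  exact isClosed_le (by fun_prop) (by fun_prop)

theorem isClosed_singleLetterBounds :
    IsClosed {z : _ × ℝ | SingleLetterBounds ch R₀ R₁ R₂ E₁ E₂ z.1 z.2} := by
  unfold SingleLetterBounds
  simp only [Set.ofPred_and, Set.ofPred_forall]
  refine (isClosed_iInter fun s => isClosed_eq (by fun_prop) (by fun_prop)).inter ?_
  refine (isClosed_rateBounds ch R₀ R₁ R₂).inter ?_
  exact (isClosed_le (by fun_prop) (by fun_prop)).inter (isClosed_le (by fun_prop) (by fun_prop))

variable {ch R₀ R₁ R₂ E₁ E₂}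

theorem exists_singleLetterBounds_zero (h : ∀ δ : ℝ, 0 < δ →
    ∃ z ∈ splitHull ch.outputEntropies, SingleLetterBounds ch R₀ R₁ R₂ E₁ E₂ z δ) :
    ∃ z ∈ splitHull ch.outputEntropies, SingleLetterBounds ch R₀ R₁ R₂ E₁ E₂ z 0 := by
  choose z hz hbounds using fun n : ℕ => h (1 / ((n : ℝ) + 1)) (by positivity)
  obtain ⟨w, hw, g, hg, hlim⟩ :=
    (isCompact_splitHull ch.continuous_outputEntropies).tendsto_subseq hz
  have hδ := (tendsto_one_div_add_atTop_nhds_zero_nat (𝕜 := ℝ)).comp hg.tendsto_atTop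
  exact ⟨w, hw, (isClosed_singleLetterBounds ch R₀ R₁ R₂ E₁ E₂).mem_of_tendsto
    (hlim.prodMk_nhds hδ) (Filter.Eventually.of_forall fun n => hbounds (g n))⟩

end SingleLetter

section TestChannel

theorem exists_kernel {A B : Type*} [Fintype B] [Nonempty B] {ρ : A → B → ℝ}
    (hρ : ∀ a b, 0 ≤ ρ a b) : ∃ κ : A → B → ℝ, (∀ a, κ a ∈ stdSimplex ℝ B) ∧
      ∀ a b, (∑ b', ρ a b') * κ a b = ρ a b := by
  classical
  have hsum (a : A) : 0 ≤ ∑ b, ρ a b := Finset.sum_nonneg fun b _ => hρ a b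
  have hfiber (a : A) : ∃ k ∈ stdSimplex ℝ B, ∀ b, (∑ b', ρ a b') * k b = ρ a b := by
    rcases (hsum a).eq_or_lt with h0 | hpos
    · exact ⟨_, single_mem_stdSimplex ℝ (Classical.arbitrary B), fun b => by
        simp [eq_zero_of_sum_eq_zero (hρ a) h0.symm]⟩
    · exact ⟨_, inv_sum_smul_mem_stdSimplex (hρ a) hpos, fun b => mul_inv_cancel_left₀ hpos.ne' _⟩
  choose κ hκ hκρ using hfiber
  exact ⟨κ, hκ, hκρ⟩

/-- The measure under which `U` and `V` are conditionally independent given `W` and `I`, with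
`(W, I) ∼ t`, `(W, U, I) ∼ r` and `(W, V, I) ∼ r'`. -/
def gluedMeasure {W U V I : Type*} (t : W → I → ℝ) (r : W → U → I → ℝ) (r' : W → V → I → ℝ)
    (w : W) (u : U) (v : V) (i : I) : ℝ :=
  r w u i * r' w v i / t w i

section Glue

variable {W U V I : Type*} {t : W → I → ℝ} {r : W → U → I → ℝ} {r' : W → V → I → ℝ}

theorem gluedMeasure_comm (w : W) (u : U) (v : V) (i : I) :
    gluedMeasure t r r' w u v i = gluedMeasure t r' r w v u i := by
  rw [gluedMeasure, mul_comm, gluedMeasure]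

variable [Fintype U] [Fintype V]

theorem gluedMeasure_nonneg (hr : ∀ w, IsDecomposition (r w) (t w))
    (hr' : ∀ w, IsDecomposition (r' w) (t w)) (w : W) (u : U) (v : V) (i : I) :
    0 ≤ gluedMeasure t r r' w u v i :=
  div_nonneg (mul_nonneg ((hr w).nonneg u i) ((hr' w).nonneg v i)) ((hr w).target_nonneg i)

theorem sum_gluedMeasure (hr : ∀ w, IsDecomposition (r w) (t w))
    (hr' : ∀ w, IsDecomposition (r' w) (t w)) (w : W) (u : U) (i : I) :
    ∑ v, gluedMeasure t r r' w u v i = r w u i := by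
  simp only [gluedMeasure, ← Finset.sum_div, ← Finset.mul_sum, (hr' w).sum_apply]
  exact mul_div_cancel_of_imp fun h0 =>
    le_antisymm (((hr w).apply_le u i).trans_eq h0) ((hr w).nonneg u i)

theorem law_of_law_eq_gluedMeasure {Ω : Type*} [Fintype Ω] {p : Ω → ℝ} {Wv : Ω → W} {Uv : Ω → U}
    {Vv : Ω → V} {Iv : Ω → I} (hr : ∀ w, IsDecomposition (r w) (t w))
    (hr' : ∀ w, IsDecomposition (r' w) (t w))
    (h : ∀ w u v i, law p (fun ω => ((Wv ω, Uv ω, Vv ω), Iv ω)) ((w, u, v), i) =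
      gluedMeasure t r r' w u v i) (w : W) (u : U) (i : I) :
    law p (fun ω => (Uv ω, Wv ω, Iv ω)) (u, w, i) = r w u i := by
  rw [← sum_gluedMeasure hr hr', ← sum_law_pair_left p Vv]
  refine Finset.sum_congr rfl fun v _ => ?_
  rw [← h]
  exact law_congr p fun ω => by simp only [Prod.mk.injEq]; tauto

end Glue

theorem law_of_injective {Ω A : Type*} [Fintype Ω] (p : Ω → ℝ) {X : Ω → A}
    (hX : Function.Injective X) (ω : Ω) : law p X (X ω) = p ω := by
  classical
  simp [law_eq_sum, hX.eq_iff]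

variable {S X Y₁ Y₂ W U V : Type*} [Fintype S] [Fintype X] [Fintype Y₁] [Fintype Y₂]
  [Fintype W] [Fintype U] [Fintype V] (ch : Channel S X Y₁ Y₂) {P : S → W × U × V × X → ℝ}

theorem letterJoint_nonneg (hP : ∀ s, P s ∈ stdSimplex ℝ (W × U × V × X))
    (ω : S × W × U × V × X × Y₁ × Y₂) : 0 ≤ letterJoint ch P ω :=
  mul_nonneg (mul_nonneg (ch.stateP_mem.1 _) ((hP _).1 _)) ((ch.trans_mem _ _).1 _)

theorem law_letterJoint_output (s : S) (w : W) (u : U) (v : V) (x : X) (y : Y₁ × Y₂) :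
    law (letterJoint ch P)
      (fun ω => ((rvY₁ ω, rvY₂ ω), (rvW ω, rvU ω, rvV ω), rvS ω, rvX ω)) (y, (w, u, v), s, x) =
      ch.stateP s * P s (w, u, v, x) * ch.trans x s y :=
  law_of_injective (letterJoint ch P)
    (X := fun ω => ((rvY₁ ω, rvY₂ ω), (rvW ω, rvU ω, rvV ω), rvS ω, rvX ω))
    (fun ω ω' h => by simp_all [Prod.ext_iff, rvS, rvW, rvU, rvV, rvX, rvY₁, rvY₂])
    (s, w, u, v, x, y)

theorem law_letterJoint (s : S) (w : W) (u : U) (v : V) (x : X) :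
    law (letterJoint ch P) (fun ω => ((rvW ω, rvU ω, rvV ω), rvS ω, rvX ω)) ((w, u, v), s, x) =
      ch.stateP s * P s (w, u, v, x) := by
  rw [← sum_law_pair_left _ fun ω => (rvY₁ ω, rvY₂ ω)]
  simp only [law_letterJoint_output, ← Finset.mul_sum, (ch.trans_mem x s).2, mul_one]

theorem isChannelOutput_letterJoint :
    IsChannelOutput (letterJoint ch P) ch.trans rvS rvX (fun ω => (rvY₁ ω, rvY₂ ω))
      fun ω => (rvW ω, rvU ω, rvV ω) := fun y z s x => by
  rw [law_letterJoint_output, law_letterJoint]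

variable {ch}

theorem exists_letterJoint_eq_gluedMeasure {t : W → S × X → ℝ} {r : W → U → S × X → ℝ}
    {r' : W → V → S × X → ℝ} (hr : ∀ w, IsDecomposition (r w) (t w))
    (hr' : ∀ w, IsDecomposition (r' w) (t w)) (ht : ∀ s, ∑ x, ∑ w, t w (s, x) = ch.stateP s) :
    ∃ P : S → W × U × V × X → ℝ, (∀ s, P s ∈ stdSimplex ℝ (W × U × V × X)) ∧
      ∀ w u v i, law (letterJoint ch P) (fun ω => ((rvW ω, rvU ω, rvV ω), rvS ω, rvX ω))
        ((w, u, v), i) = gluedMeasure t r r' w u v i := by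
  set ρ : S → W × U × V × X → ℝ := fun s z => gluedMeasure t r r' z.1 z.2.1 z.2.2.1 (s, z.2.2.2)
  have hρ (s z) : 0 ≤ ρ s z := gluedMeasure_nonneg hr hr' _ _ _ _
  have hρsum (s : S) : ∑ z, ρ s z = ch.stateP s := by
    simp only [ρ, Fintype.sum_prod_type, ← Finset.sum_comm (γ := X), sum_gluedMeasure hr hr',
      (hr _).sum_apply, ht]
  have hne : Nonempty (W × U × V × X) := by
    by_contra hempty
    rw [not_nonempty_iff] at hempty
    simpa [← hρsum] using ch.stateP_mem.2
  obtain ⟨P, hP, hPρ⟩ := exists_kernel hρ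
  refine ⟨P, hP, fun w u v i => ?_⟩
  rw [law_letterJoint, ← hρsum, hPρ]

theorem exists_testChannel {z : (S × X → ℝ) × (ℝ × ℝ) × (ℝ × ℝ) × (ℝ × ℝ)}
    (hz : z ∈ splitHull ch.outputEntropies) (hS : ∀ s, ∑ x, z.1 (s, x) = ch.stateP s) :
    ∃ (a b c : ℕ) (P : S → Fin a × Fin b × Fin c × X → ℝ),
      (∀ s, P s ∈ stdSimplex ℝ (Fin a × Fin b × Fin c × X)) ∧
      letterPoint (letterJoint ch P) rvS rvX (fun ω => (rvY₁ ω, rvY₂ ω)) rvW rvU rvV = z := by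
  obtain ⟨a, b, c, t, r, r', hr, hr', rfl⟩ :=
    exists_isDecomposition_of_mem_splitHull ch.outputEntropies_smul hz
  simp only [Prod.fst_sum, Finset.sum_apply] at hS
  obtain ⟨P, hP, hlaw⟩ := exists_letterJoint_eq_gluedMeasure hr hr' hS
  have hlaw' (w v u i) : law (letterJoint ch P) (fun ω => ((rvW ω, rvV ω, rvU ω), rvS ω, rvX ω))
      ((w, v, u), i) = gluedMeasure t r' r w v u i := by
    rw [gluedMeasure_comm, ← hlaw]
    exact law_congr _ fun ω => by simp only [Prod.mk.injEq]; tauto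
  have hWU := law_of_law_eq_gluedMeasure hr hr' hlaw
  have hWV := law_of_law_eq_gluedMeasure hr' hr hlaw'
  have hW (w : Fin a) (i : S × X) :
      law (letterJoint ch P) (fun ω => (rvW ω, rvS ω, rvX ω)) (w, i) = t w i := by
    rw [← sum_law_pair_left _ rvU, ← (hr w).sum_apply]
    exact Finset.sum_congr rfl fun u _ => hWU w u i
  refine ⟨a, b, c, P, hP, ?_⟩
  rw [(isChannelOutput_letterJoint ch).letterPoint_eq_sum (letterJoint_nonneg ch hP)]
  simp only [hW, hWU, hWV]

end TestChannel

section Sequences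

variable {A B : Type*} {n : ℕ}

/-- The entries of a sequence before position `k`; the others are hidden. -/
def before (x : Fin n → A) (k : ℕ) (j : Fin n) : Option A := if j.1 < k then some (x j) else none

/-- The entries of a sequence from position `k` on; the others are hidden. -/
def fromPos (x : Fin n → A) (k : ℕ) (j : Fin n) : Option A := if k ≤ j.1 then some (x j) else none

variable {x x' : Fin n → A} {k : ℕ}

theorem before_eq_iff : before x k = before x' k ↔ ∀ j : Fin n, j.1 < k → x j = x' j := by
  rw [funext_iff]
  refine forall_congr' fun j => ?_
  by_cases h : j.1 < k <;> simp [before, h]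

theorem fromPos_eq_iff : fromPos x k = fromPos x' k ↔ ∀ j : Fin n, k ≤ j.1 → x j = x' j := by
  rw [funext_iff]
  refine forall_congr' fun j => ?_
  by_cases h : k ≤ j.1 <;> simp [fromPos, h]

theorem before_length_eq_iff : before x n = before x' n ↔ x = x' := by
  rw [before_eq_iff, funext_iff]
  simp

theorem before_zero_eq : before x 0 = before x' 0 := by
  simp [before_eq_iff]

theorem fromPos_zero_eq_iff : fromPos x 0 = fromPos x' 0 ↔ x = x' := by
  rw [fromPos_eq_iff, funext_iff]
  simp

theorem fromPos_length_eq : fromPos x n = fromPos x' n :=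
  fromPos_eq_iff.2 fun j h => absurd j.2 h.not_gt

theorem before_succ_eq_iff (i : Fin n) :
    before x (i + 1) = before x' (i + 1) ↔ x i = x' i ∧ before x i = before x' i := by
  simp only [before_eq_iff, Nat.lt_succ_iff, le_iff_lt_or_eq, or_imp, forall_and, Fin.val_inj,
    forall_eq, and_comm]

theorem fromPos_eq_succ_iff (i : Fin n) :
    fromPos x i = fromPos x' i ↔ x i = x' i ∧ fromPos x (i + 1) = fromPos x' (i + 1) := by
  simp only [fromPos_eq_iff, Nat.succ_le_iff, le_iff_eq_or_lt (a := i.1), or_imp, forall_and,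
    Fin.val_inj, forall_eq']

theorem sum_fin_succ_sub (f : ℕ → ℝ) : ∑ i : Fin n, (f (i + 1) - f i) = f n - f 0 := by
  rw [Fin.sum_univ_eq_sum_range fun i => f (i + 1) - f i, Finset.sum_range_sub]

variable {Ω C : Type*} [Fintype Ω] [Fintype A] [Fintype B] [Fintype C] {p : Ω → ℝ}
  (hp : ∀ ω, 0 ≤ p ω) (x : Ω → Fin n → A) (y : Ω → Fin n → B) (Z : Ω → C)
include hp

theorem condEntropy_sequence :
    condEntropy p x Z =
      ∑ i : Fin n, condEntropy p (fun ω => x ω i) fun ω => (before (x ω) i, Z ω) := by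
  set F : ℕ → ℝ := fun k => entropy p fun ω => (before (x ω) k, Z ω)
  have hterm (i : Fin n) : condEntropy p (fun ω => x ω i) (fun ω => (before (x ω) i, Z ω)) =
      F (i + 1) - F i := by
    rw [condEntropy_eq_sub hp]
    congr 1
    exact entropy_congr p fun ω ω' => by simp only [Prod.mk.injEq, before_succ_eq_iff, and_assoc]
  have hlast : entropy p (fun ω => (x ω, Z ω)) = F n :=
    entropy_congr p fun ω ω' => by simp only [Prod.mk.injEq, before_length_eq_iff]
  have hfirst : entropy p Z = F 0 := entropy_congr p fun ω ω' => by
    simp only [Prod.mk.injEq, iff_true_intro (before_zero_eq (x := x ω)), true_and]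
  rw [condEntropy_eq_sub hp, hlast, hfirst, ← sum_fin_succ_sub]
  exact Finset.sum_congr rfl fun i _ => (hterm i).symm

theorem condEntropy_sequence_le {D : Type*} [Fintype D] {T : Fin n → Ω → D}
    (hT : ∀ i, (T i).FactorsThrough Z) :
    condEntropy p x Z ≤ ∑ i, condEntropy p (fun ω => x ω i) (T i) := by
  rw [condEntropy_sequence hp]
  exact Finset.sum_le_sum fun i _ => condEntropy_le_of_factorsThrough_right hp _
    fun ω ω' h => hT i (congrArg Prod.snd h)

theorem sum_condEntropy_before_fromPos_le :
    ∑ i : Fin n, condEntropy p (fun ω => x ω i)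
      (fun ω => (Z ω, before (x ω) i, fromPos (y ω) (i + 1))) ≤ condEntropy p x Z := by
  rw [condEntropy_sequence hp]
  exact Finset.sum_le_sum fun i _ => condEntropy_le_of_factorsThrough_right hp _
    fun ω ω' h => by simp_all only [Prod.mk.injEq]

/-- Csiszár's sum identity. -/
theorem condEntropy_sub_sum_before_fromPos :
    condEntropy p x Z - ∑ i : Fin n, condEntropy p (fun ω => x ω i)
        (fun ω => (Z ω, before (x ω) i, fromPos (y ω) (i + 1))) =
      condEntropy p y Z - ∑ i : Fin n, condEntropy p (fun ω => y ω i)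
        (fun ω => (Z ω, before (x ω) i, fromPos (y ω) (i + 1))) := by
  set F : ℕ → ℕ → ℝ := fun k l => entropy p fun ω => (Z ω, before (x ω) k, fromPos (y ω) l)
  have hx (i : Fin n) : condEntropy p (fun ω => x ω i)
      (fun ω => (Z ω, before (x ω) i, fromPos (y ω) (i + 1))) =
      F (i + 1) (i + 1) - F i (i + 1) := by
    rw [condEntropy_eq_sub hp]
    congr 1
    exact entropy_congr p fun ω ω' => by simp only [Prod.mk.injEq, before_succ_eq_iff]; tauto
  have hy (i : Fin n) : condEntropy p (fun ω => y ω i)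
      (fun ω => (Z ω, before (x ω) i, fromPos (y ω) (i + 1))) = F i i - F i (i + 1) := by
    rw [condEntropy_eq_sub hp]
    congr 1
    exact entropy_congr p fun ω ω' => by simp only [Prod.mk.injEq, fromPos_eq_succ_iff]; tauto
  have hlast : entropy p (fun ω => (x ω, Z ω)) = F n n := entropy_congr p fun ω ω' => by
    simp only [Prod.mk.injEq, before_length_eq_iff, iff_true_intro (fromPos_length_eq (x := y ω))]
    tauto
  have hfirst : entropy p (fun ω => (y ω, Z ω)) = F 0 0 := entropy_congr p fun ω ω' => by
    simp only [Prod.mk.injEq, fromPos_zero_eq_iff, iff_true_intro (before_zero_eq (x := x ω))]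
    tauto
  have htele := sum_fin_succ_sub (n := n) fun k => F k k
  simp only [condEntropy_eq_sub hp x, condEntropy_eq_sub hp y, hx, hy, hlast, hfirst,
    Finset.sum_sub_distrib] at htele ⊢
  linarith

end Sequences

section BlockCode

variable {n : ℕ} {M₀ M₁ M₂ S X Y₁ Y₂ : Type*}

namespace Outcome

/-- The messages `(M₀, M₁, M₂)`. -/
def messages (ω : Outcome n M₀ M₁ M₂ S Y₁ Y₂) : M₀ × M₁ × M₂ :=
  (ω.m₀, ω.m₁, ω.m₂)

/-- The pair of channel outputs at time `i`. -/
def output (i : Fin n) (ω : Outcome n M₀ M₁ M₂ S Y₁ Y₂) : Y₁ × Y₂ := (ω.y₁ i, ω.y₂ i)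

/-- The outcome with the channel outputs at time `i` replaced by `b`. -/
def replaceOutput (i : Fin n) (ω : Outcome n M₀ M₁ M₂ S Y₁ Y₂) (b : Y₁ × Y₂) :
    Outcome n M₀ M₁ M₂ S Y₁ Y₂ :=
  { ω with y₁ := Function.update ω.y₁ i b.1, y₂ := Function.update ω.y₂ i b.2 }

end Outcome

namespace Code

variable [Fintype M₀] [Fintype M₁] [Fintype M₂] [Fintype S] [Fintype Y₁] [Fintype Y₂]
  (c : Code n M₀ M₁ M₂ S X Y₁ Y₂) (ch : Channel S X Y₁ Y₂)

theorem joint_nonneg (ω : Outcome n M₀ M₁ M₂ S Y₁ Y₂) : 0 ≤ c.joint ch ω := by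
  have hstate : 0 ≤ ∏ i, ch.stateP (ω.s i) := Finset.prod_nonneg fun i _ => ch.stateP_mem.1 _
  have htrans : 0 ≤ ∏ i, ch.trans (c.input ω i) (ω.s i) (ω.y₁ i, ω.y₂ i) :=
    Finset.prod_nonneg fun i _ => (ch.trans_mem _ _).1 _
  unfold joint
  positivity

theorem joint_mul_trans (i : Fin n) (ω : Outcome n M₀ M₁ M₂ S Y₁ Y₂) (b : Y₁ × Y₂) :
    c.joint ch ω * ch.trans (c.input ω i) (ω.s i) b =
      c.joint ch (ω.replaceOutput i b) * ch.trans (c.input ω i) (ω.s i) (ω.output i) := by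
  classical
  have hrest : ∏ j ∈ Finset.univ.erase i, ch.trans (c.input ω j) (ω.s j)
      ((ω.replaceOutput i b).output j) =
      ∏ j ∈ Finset.univ.erase i, ch.trans (c.input ω j) (ω.s j) (ω.output j) :=
    Finset.prod_congr rfl fun j hj => by
      simp [Outcome.output, Outcome.replaceOutput, Finset.ne_of_mem_erase hj]
  have hprod (ω' : Outcome n M₀ M₁ M₂ S Y₁ Y₂) :
      ∏ j, ch.trans (c.input ω j) (ω.s j) (ω'.output j) =
        ch.trans (c.input ω i) (ω.s i) (ω'.output i) *
          ∏ j ∈ Finset.univ.erase i, ch.trans (c.input ω j) (ω.s j) (ω'.output j) :=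
    (Finset.mul_prod_erase _ _ (Finset.mem_univ i)).symm
  have hω := hprod ω
  have hω' := hprod (ω.replaceOutput i b)
  rw [hrest] at hω'
  simp only [Outcome.output, Outcome.replaceOutput, Function.update_self] at hω hω'
  simp only [joint, input, Outcome.output, Outcome.replaceOutput] at hω hω' ⊢
  rw [hω, hω']
  ring

theorem isChannelOutput_joint (i : Fin n) {Z : Type*} {Zv : Outcome n M₀ M₁ M₂ S Y₁ Y₂ → Z}
    (hZv : ∀ ω b, Zv (ω.replaceOutput i b) = Zv ω) :
    IsChannelOutput (c.joint ch) ch.trans (fun ω => ω.s i) (fun ω => c.input ω i)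
      (Outcome.output i) Zv :=
  isChannelOutput_of_resampling (Outcome.replaceOutput i) (fun x s => (ch.trans_mem x s).2)
    (fun ω b => by simp [Outcome.output, Outcome.replaceOutput])
    (fun ω b => by simp [Outcome.output, Outcome.replaceOutput])
    (fun _ _ => rfl) (fun _ _ => rfl) hZv (c.joint_mul_trans ch i)

theorem sum_prod_trans (x : Fin n → X) (s : Fin n → S) :
    ∑ y : (Fin n → Y₁) × (Fin n → Y₂), ∏ i, ch.trans (x i) (s i) (y.1 i, y.2 i) = 1 := by
  rw [← (Equiv.arrowProdEquivProdArrow (Fin n) (fun _ => Y₁) fun _ => Y₂).sum_comp]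
  refine (Fintype.prod_sum fun i y => ch.trans (x i) (s i) y).symm.trans ?_
  simp [(ch.trans_mem _ _).2]

theorem law_messages_state (m : M₀ × M₁ × M₂) (s : Fin n → S) :
    law (c.joint ch) (fun ω => (ω.messages, ω.s)) (m, s) =
      (Fintype.card (M₀ × M₁ × M₂) : ℝ)⁻¹ * ∏ i, ch.stateP (s i) := by
  have hpoint (y : (Fin n → Y₁) × (Fin n → Y₂)) :
      law (c.joint ch) (fun ω => ((ω.y₁, ω.y₂), ω.messages, ω.s)) (y, m, s) =
        c.joint ch ⟨m.1, m.2.1, m.2.2, s, y.1, y.2⟩ :=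
    law_of_injective (c.joint ch) (X := fun ω => ((ω.y₁, ω.y₂), ω.messages, ω.s))
      (fun ω ω' h => by cases ω; cases ω'; simp_all [Outcome.messages])
      ⟨m.1, m.2.1, m.2.2, s, y.1, y.2⟩
  rw [← sum_law_pair_left _ fun ω : Outcome n M₀ M₁ M₂ S Y₁ Y₂ => (ω.y₁, ω.y₂)]
  simp only [hpoint, joint, input, ← Finset.mul_sum, sum_prod_trans, mul_one, Fintype.card_prod,
    Nat.cast_mul, mul_assoc]

variable [Nonempty M₀] [Nonempty M₁] [Nonempty M₂]

theorem law_state (s : Fin n → S) :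
    law (c.joint ch) (fun ω => ω.s) s = ∏ i, ch.stateP (s i) := by
  have hcard : (Fintype.card (M₀ × M₁ × M₂) : ℝ) ≠ 0 := Nat.cast_ne_zero.2 Fintype.card_ne_zero
  rw [← sum_law_pair_left _ Outcome.messages]
  simp only [law_messages_state, Finset.sum_const, Finset.card_univ, nsmul_eq_mul]
  exact mul_inv_cancel_left₀ hcard _

theorem sum_joint : ∑ ω, c.joint ch ω = 1 := by
  rw [← sum_law _ fun ω : Outcome n M₀ M₁ M₂ S Y₁ Y₂ => ω.s]
  simp only [law_state, ← Fintype.prod_sum, ch.stateP_mem.2, Finset.prod_const_one]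

theorem joint_mem_stdSimplex : c.joint ch ∈ stdSimplex ℝ (Outcome n M₀ M₁ M₂ S Y₁ Y₂) :=
  ⟨c.joint_nonneg ch, c.sum_joint ch⟩

theorem law_state_apply (i : Fin n) (a : S) :
    law (c.joint ch) (fun ω => ω.s i) a = ch.stateP a := by
  classical
  have hsum := sum_mul_comp (c.joint ch) (fun ω => ω.s) fun s => if s i = a then (1 : ℝ) else 0
  calc law (c.joint ch) (fun ω => ω.s i) a
      = ∑ s : Fin n → S, (∏ j, ch.stateP (s j)) * if s i = a then 1 else 0 := by
        simpa only [mul_ite, mul_one, mul_zero, law_state, ← law_eq_sum] using hsum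
    _ = ∑ s : Fin n → S, ∏ j, ch.stateP (s j) * if j = i then if s j = a then 1 else 0 else 1 := by
        simp only [Finset.prod_mul_distrib, Finset.prod_ite_eq', Finset.mem_univ, if_true]
    _ = ∏ j, ∑ b, ch.stateP b * if j = i then if b = a then 1 else 0 else 1 :=
        (Fintype.prod_sum fun j b =>
          ch.stateP b * if j = i then if b = a then 1 else 0 else 1).symm
    _ = ch.stateP a := by
        rw [Finset.prod_eq_single i (fun j _ hj => by simp [hj, ch.stateP_mem.2]) (by simp)]
        simp

theorem entropy_state : entropy (c.joint ch) (fun ω => ω.s) = n * ch.stateEntropy := by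
  have hletter (i : Fin n) :
      ∑ ω, c.joint ch ω * Real.logb 2 (ch.stateP (ω.s i)) = -ch.stateEntropy := by
    rw [sum_mul_comp _ (fun ω : Outcome n M₀ M₁ M₂ S Y₁ Y₂ => ω.s i)
      fun s => Real.logb 2 (ch.stateP s)]
    simp only [law_state_apply, Channel.stateEntropy, negMulLog2_eq, Finset.sum_neg_distrib,
      neg_neg]
  have hblock (ω : Outcome n M₀ M₁ M₂ S Y₁ Y₂) :
      c.joint ch ω * Real.logb 2 (law (c.joint ch) (fun ω => ω.s) ω.s) =
        ∑ i, c.joint ch ω * Real.logb 2 (ch.stateP (ω.s i)) := by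
    rcases (c.joint_nonneg ch ω).eq_or_lt with h0 | h0
    · simp [← h0]
    · have hpos := law_pos (c.joint_nonneg ch) (fun ω => ω.s) h0
      rw [law_state] at hpos ⊢
      rw [Real.logb_prod _ _ fun i hi => Finset.prod_ne_zero_iff.1 hpos.ne' i hi, Finset.mul_sum]
  rw [entropy_eq_sum]
  simp only [hblock]
  rw [Finset.sum_comm]
  simp [hletter]

theorem condEntropy_m₀ :
    condEntropy (c.joint ch) (fun ω => ω.m₀) (fun ω => (ω.m₁, ω.m₂, ω.s)) =
      Real.logb 2 (Fintype.card M₀) := by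
  refine condEntropy_eq_logb_card (c.joint_nonneg ch) (c.sum_joint ch) fun a a' ⟨m₁, m₂, s⟩ => ?_
  have h (a : M₀) : law (c.joint ch) (fun ω => (ω.m₀, ω.m₁, ω.m₂, ω.s)) (a, m₁, m₂, s) = _ :=
    (law_congr _ (by simp [Outcome.messages, and_assoc])).trans
      (c.law_messages_state ch (a, m₁, m₂) s)
  rw [h, h]

theorem condEntropy_m₁ :
    condEntropy (c.joint ch) (fun ω => ω.m₁) (fun ω => (ω.m₂, ω.m₀, ω.s)) =
      Real.logb 2 (Fintype.card M₁) := by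
  refine condEntropy_eq_logb_card (c.joint_nonneg ch) (c.sum_joint ch) fun a a' ⟨m₂, m₀, s⟩ => ?_
  have h (a : M₁) : law (c.joint ch) (fun ω => (ω.m₁, ω.m₂, ω.m₀, ω.s)) (a, m₂, m₀, s) = _ :=
    (law_congr _ fun ω => by simp only [Outcome.messages, Prod.mk.injEq]; tauto).trans
      (c.law_messages_state ch (m₀, a, m₂) s)
  rw [h, h]

theorem condEntropy_m₂ :
    condEntropy (c.joint ch) (fun ω => ω.m₂) (fun ω => (ω.m₁, ω.m₀, ω.s)) =
      Real.logb 2 (Fintype.card M₂) := by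
  refine condEntropy_eq_logb_card (c.joint_nonneg ch) (c.sum_joint ch) fun a a' ⟨m₁, m₀, s⟩ => ?_
  have h (a : M₂) : law (c.joint ch) (fun ω => (ω.m₂, ω.m₁, ω.m₀, ω.s)) (a, m₁, m₀, s) = _ :=
    (law_congr _ fun ω => by simp only [Outcome.messages, Prod.mk.injEq]; tauto).trans
      (c.law_messages_state ch (m₀, m₁, a) s)
  rw [h, h]

end Code

end BlockCode

section Converse

variable {n : ℕ} {M₀ M₁ M₂ S X Y₁ Y₂ B C : Type*}

/-- The auxiliary variable at time `i`: a variable `Cv` together with the past of the first output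
sequence and the future of the second. -/
def auxVar (Cv : Outcome n M₀ M₁ M₂ S Y₁ Y₂ → C) (i : Fin n)
    (ω : Outcome n M₀ M₁ M₂ S Y₁ Y₂) : C × (Fin n → Option Y₁) × (Fin n → Option Y₂) :=
  (Cv ω, before ω.y₁ i, fromPos ω.y₂ (i + 1))

theorem auxVar_replaceOutput {Cv : Outcome n M₀ M₁ M₂ S Y₁ Y₂ → C} {i : Fin n}
    (hCv : ∀ ω b, Cv (ω.replaceOutput i b) = Cv ω) (ω : Outcome n M₀ M₁ M₂ S Y₁ Y₂)
    (b : Y₁ × Y₂) : auxVar Cv i (ω.replaceOutput i b) = auxVar Cv i ω := by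
  simp only [auxVar, hCv, Prod.mk.injEq, true_and, before_eq_iff, fromPos_eq_iff]
  exact ⟨fun j hj => Function.update_of_ne (by omega) _ _,
    fun j hj => Function.update_of_ne (by omega) _ _⟩

namespace Code

variable [Fintype M₀] [Fintype M₁] [Fintype M₂] [Fintype S] [Fintype Y₁] [Fintype Y₂] [Fintype B]
  [Fintype C]
  (c : Code n M₀ M₁ M₂ S X Y₁ Y₂) (ch : Channel S X Y₁ Y₂)

/-- `(H(Y₁ⁿ | C), H(Y₂ⁿ | C))` -/
def blockEntropies (Cv : Outcome n M₀ M₁ M₂ S Y₁ Y₂ → C) : ℝ × ℝ :=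
  (condEntropy (c.joint ch) (fun ω => ω.y₁) Cv, condEntropy (c.joint ch) (fun ω => ω.y₂) Cv)

/-- The sums over `i` of `H(Y₁ᵢ | C, Y₁^{i-1}, Y₂ᵢ₊₁ⁿ)` and `H(Y₂ᵢ | C, Y₁^{i-1}, Y₂ᵢ₊₁ⁿ)`. -/
def letterEntropies (Cv : Outcome n M₀ M₁ M₂ S Y₁ Y₂ → C) : ℝ × ℝ :=
  ∑ i, condEntropies (c.joint ch) (Outcome.output i) (auxVar Cv i)

/-- The two sides of the Csiszár sum identity. -/
def csiszarGap (Cv : Outcome n M₀ M₁ M₂ S Y₁ Y₂ → C) : ℝ :=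
  (c.blockEntropies ch Cv).1 - (c.letterEntropies ch Cv).1

theorem letterEntropies_congr {D : Type*} [Fintype D] {Cv : Outcome n M₀ M₁ M₂ S Y₁ Y₂ → C}
    {Dv : Outcome n M₀ M₁ M₂ S Y₁ Y₂ → D} (h : ∀ ω ω', Cv ω = Cv ω' ↔ Dv ω = Dv ω') :
    c.letterEntropies ch Cv = c.letterEntropies ch Dv :=
  Finset.sum_congr rfl fun i _ => condEntropies_congr _ _ fun ω ω' => by
    simp only [auxVar, Prod.mk.injEq, h]

theorem csiszarGap_nonneg (Cv : Outcome n M₀ M₁ M₂ S Y₁ Y₂ → C) : 0 ≤ c.csiszarGap ch Cv := by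
  rw [csiszarGap, letterEntropies, Prod.fst_sum, sub_nonneg]
  exact sum_condEntropy_before_fromPos_le (c.joint_nonneg ch) (fun ω => ω.y₁) (fun ω => ω.y₂) Cv

theorem blockEntropies_eq (Cv : Outcome n M₀ M₁ M₂ S Y₁ Y₂ → C) :
    c.blockEntropies ch Cv =
      c.letterEntropies ch Cv + (c.csiszarGap ch Cv, c.csiszarGap ch Cv) := by
  have h : c.csiszarGap ch Cv = (c.blockEntropies ch Cv).2 - (c.letterEntropies ch Cv).2 := by
    rw [csiszarGap, letterEntropies, Prod.fst_sum, Prod.snd_sum]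
    exact condEntropy_sub_sum_before_fromPos (c.joint_nonneg ch) (fun ω => ω.y₁) (fun ω => ω.y₂) Cv
  refine Prod.ext ?_ ?_
  · simp only [Prod.fst_add, csiszarGap, add_sub_cancel]
  · simp only [Prod.snd_add, h, add_sub_cancel]

/-- The sum over `i` of the joint pmfs of `(Sᵢ, Xᵢ)`. -/
def stateInputMass : S × X → ℝ := ∑ i, law (c.joint ch) fun ω => (ω.s i, c.input ω i)

/-- The sum over `i` of the `letterPoint`s with `Wᵢ = (M₀, Sⁿ, Y₁^{i-1}, Y₂ᵢ₊₁ⁿ)`, `U = M₁` and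
`V = M₂`. -/
def blockPoint : (S × X → ℝ) × (ℝ × ℝ) × (ℝ × ℝ) × (ℝ × ℝ) :=
  (c.stateInputMass ch, c.letterEntropies ch fun ω => (ω.m₀, ω.s),
    c.letterEntropies ch fun ω => (ω.m₁, ω.m₀, ω.s),
    c.letterEntropies ch fun ω => (ω.m₂, ω.m₀, ω.s))

theorem blockPoint_eq_sum : c.blockPoint ch = ∑ i,
    letterPoint (c.joint ch) (fun ω => ω.s i) (fun ω => c.input ω i) (Outcome.output i)
      (auxVar (fun ω => (ω.m₀, ω.s)) i) (fun ω => ω.m₁) fun ω => ω.m₂ := by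
  refine Prod.ext ?_ (Prod.ext ?_ (Prod.ext ?_ ?_)) <;>
    simp only [blockPoint, letterPoint, Prod.fst_sum, Prod.snd_sum, stateInputMass, letterEntropies]
  all_goals
    refine Finset.sum_congr rfl fun i _ => condEntropies_congr _ _ fun ω ω' => ?_
    simp only [auxVar, Prod.mk.injEq]
    grind

theorem errorProb_nonneg : 0 ≤ c.errorProb ch :=
  prob_nonneg (c.joint_nonneg ch) _

/-- Fano's bound on the equivocation of the message pair of either receiver. -/
def fanoBound : ℝ :=
  1 + c.errorProb ch * (Real.logb 2 (Fintype.card M₀) + Real.logb 2 (Fintype.card M₁) +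
    Real.logb 2 (Fintype.card M₂))

section Fano

variable [Nonempty M₀] [Nonempty M₁] [Nonempty M₂]

theorem one_le_fanoBound : 1 ≤ c.fanoBound ch := by
  have h₀ := logb_card_nonneg M₀
  have h₁ := logb_card_nonneg M₁
  have h₂ := logb_card_nonneg M₂
  exact le_add_of_nonneg_right (mul_nonneg (c.errorProb_nonneg ch) (by positivity))

theorem condEntropy_decoded₁_le :
    condEntropy (c.joint ch) (fun ω => (ω.m₀, ω.m₁)) (fun ω => ω.y₁) ≤ c.fanoBound ch := by
  have herr : prob (c.joint ch) {ω | c.dec₁ ω.y₁ ≠ (ω.m₀, ω.m₁)} ≤ c.errorProb ch :=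
    prob_mono (c.joint_nonneg ch) fun ω => Or.inl
  refine (fano (c.joint_nonneg ch) (c.sum_joint ch) _ _ c.dec₁).trans
    (add_le_add_right (mul_le_mul herr ?_ (logb_card_nonneg _) (c.errorProb_nonneg ch)) 1)
  rw [Fintype.card_prod, Nat.cast_mul, Real.logb_mul (by simp) (by simp)]
  exact le_add_of_nonneg_right (logb_card_nonneg M₂)

theorem condEntropy_decoded₂_le :
    condEntropy (c.joint ch) (fun ω => (ω.m₀, ω.m₂)) (fun ω => ω.y₂) ≤ c.fanoBound ch := by
  have herr : prob (c.joint ch) {ω | c.dec₂ ω.y₂ ≠ (ω.m₀, ω.m₂)} ≤ c.errorProb ch :=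
    prob_mono (c.joint_nonneg ch) fun ω => Or.inr
  refine (fano (c.joint_nonneg ch) (c.sum_joint ch) _ _ c.dec₂).trans
    (add_le_add_right (mul_le_mul herr ?_ (logb_card_nonneg _) (c.errorProb_nonneg ch)) 1)
  rw [Fintype.card_prod, Nat.cast_mul, Real.logb_mul (by simp) (by simp)]
  linarith [logb_card_nonneg M₁]

variable {Xv : Outcome n M₀ M₁ M₂ S Y₁ Y₂ → B}

theorem condEntropy_le_of_decoded₁ (hX : Xv.FactorsThrough fun ω => (ω.m₀, ω.m₁))
    (Cv : Outcome n M₀ M₁ M₂ S Y₁ Y₂ → C) :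
    condEntropy (c.joint ch) Xv Cv ≤ (c.blockEntropies ch Cv).1 -
      (c.blockEntropies ch fun ω => (Xv ω, Cv ω)).1 + c.fanoBound ch :=
  (condEntropy_le_condMutualInfo_add (c.joint_nonneg ch) Xv (fun ω => ω.y₁) Cv).trans
    (add_le_add_right ((condEntropy_le_of_factorsThrough_left (c.joint_nonneg ch) hX _).trans
      (c.condEntropy_decoded₁_le ch)) _)

theorem condEntropy_le_of_decoded₂ (hX : Xv.FactorsThrough fun ω => (ω.m₀, ω.m₂))
    (Cv : Outcome n M₀ M₁ M₂ S Y₁ Y₂ → C) :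
    condEntropy (c.joint ch) Xv Cv ≤ (c.blockEntropies ch Cv).2 -
      (c.blockEntropies ch fun ω => (Xv ω, Cv ω)).2 + c.fanoBound ch :=
  (condEntropy_le_condMutualInfo_add (c.joint_nonneg ch) Xv (fun ω => ω.y₂) Cv).trans
    (add_le_add_right ((condEntropy_le_of_factorsThrough_left (c.joint_nonneg ch) hX _).trans
      (c.condEntropy_decoded₂_le ch)) _)

theorem logb_card_m₁_le : Real.logb 2 (Fintype.card M₁) ≤
    (c.blockEntropies ch fun ω => (ω.m₀, ω.s)).1 -
      (c.blockEntropies ch fun ω => (ω.m₁, ω.m₀, ω.s)).1 + c.fanoBound ch := by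
  refine le_trans ?_ (c.condEntropy_le_of_decoded₁ ch (fun _ _ h => (Prod.mk.inj h).2) _)
  rw [← c.condEntropy_m₁ ch]
  exact condEntropy_le_of_factorsThrough_right (c.joint_nonneg ch) _
    fun _ _ h => (Prod.mk.inj h).2

theorem logb_card_m₂_le : Real.logb 2 (Fintype.card M₂) ≤
    (c.blockEntropies ch fun ω => (ω.m₀, ω.s)).2 -
      (c.blockEntropies ch fun ω => (ω.m₂, ω.m₀, ω.s)).2 + c.fanoBound ch := by
  refine le_trans ?_ (c.condEntropy_le_of_decoded₂ ch (fun _ _ h => (Prod.mk.inj h).2) _)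
  rw [← c.condEntropy_m₂ ch]
  exact condEntropy_le_of_factorsThrough_right (c.joint_nonneg ch) _
    fun _ _ h => (Prod.mk.inj h).2

end Fano

variable [Fintype X]

theorem condEntropy_output_state_le (π : Y₁ × Y₂ → B) :
    condEntropy (c.joint ch) (fun ω i => π (ω.output i)) (fun ω => ω.s) ≤
      outputEntropy (marginalKernel π ch.trans) (c.stateInputMass ch) := by
  have hp := c.joint_nonneg ch
  have hout (i : Fin n) :=
    (c.isChannelOutput_joint ch i (Zv := fun _ => ()) fun _ _ => rfl).marginal π
  calc condEntropy (c.joint ch) (fun ω i => π (ω.output i)) (fun ω => ω.s)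
      ≤ ∑ i, condEntropy (c.joint ch) (fun ω => π (ω.output i)) fun ω => ω.s i :=
        condEntropy_sequence_le hp _ _ fun i _ _ h => congrFun h i
    _ = ∑ i, outputEntropy (marginalKernel π ch.trans)
          (law (c.joint ch) fun ω => (ω.s i, c.input ω i)) :=
        Finset.sum_congr rfl fun i _ => (hout i).condEntropy_state hp
    _ ≤ outputEntropy (marginalKernel π ch.trans) (c.stateInputMass ch) :=
        sum_outputEntropy_le (marginalKernel_nonneg π fun x s => (ch.trans_mem x s).1)
          fun i => law_nonneg hp _

theorem condEntropy_state_output_le (π : Y₁ × Y₂ → B) :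
    condEntropy (c.joint ch) (fun ω => ω.s) (fun ω i => π (ω.output i)) ≤
      equivocation (marginalKernel π ch.trans) (c.stateInputMass ch) := by
  have hp := c.joint_nonneg ch
  have hout (i : Fin n) :=
    (c.isChannelOutput_joint ch i (Zv := fun _ => ()) fun _ _ => rfl).marginal π
  calc condEntropy (c.joint ch) (fun ω => ω.s) (fun ω i => π (ω.output i))
      ≤ ∑ i, condEntropy (c.joint ch) (fun ω => ω.s i) fun ω => π (ω.output i) :=
        condEntropy_sequence_le hp _ _ fun i _ _ h => congrFun h i
    _ = ∑ i, equivocation (marginalKernel π ch.trans)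
          (law (c.joint ch) fun ω => (ω.s i, c.input ω i)) :=
        Finset.sum_congr rfl fun i _ => (hout i).condEntropy_of_output hp
    _ ≤ equivocation (marginalKernel π ch.trans) (c.stateInputMass ch) :=
        sum_equivocation_le (marginalKernel_nonneg π fun x s => (ch.trans_mem x s).1)
          fun i => law_nonneg hp _

theorem blockEntropies_state_le :
    c.blockEntropies ch (fun ω => ω.s) ≤ ch.outputEntropies (c.stateInputMass ch) :=
  ⟨c.condEntropy_output_state_le ch Prod.fst, c.condEntropy_output_state_le ch Prod.snd⟩

theorem letterEntropies_messages_state :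
    c.letterEntropies ch (fun ω => (ω.messages, ω.s)) =
      (noiseEntropy ch.trans₁ (c.stateInputMass ch),
        noiseEntropy ch.trans₂ (c.stateInputMass ch)) := by
  have hp := c.joint_nonneg ch
  have hout (i : Fin n) := c.isChannelOutput_joint ch i
    (auxVar_replaceOutput (Cv := fun ω => (ω.messages, ω.s)) (i := i) fun _ _ => rfl)
  have haux (i : Fin n) (ω ω' : Outcome n M₀ M₁ M₂ S Y₁ Y₂) :
      auxVar (fun ω => (ω.messages, ω.s)) i ω = auxVar (fun ω => (ω.messages, ω.s)) i ω' ↔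
        (auxVar (fun ω => (ω.messages, ω.s)) i ω, ω.s i, c.input ω i) =
          (auxVar (fun ω => (ω.messages, ω.s)) i ω', ω'.s i, c.input ω' i) := by
    simp only [auxVar, Outcome.messages, input, Prod.mk.injEq]
    grind
  have hletter (i : Fin n) := condEntropies_congr (c.joint ch) (Outcome.output i) (haux i)
  simp only [letterEntropies, stateInputMass, noiseEntropy_sum, hletter]
  refine Prod.ext ?_ ?_ <;> simp only [Prod.fst_sum, Prod.snd_sum]
  · exact Finset.sum_congr rfl fun i _ =>
      ((hout i).marginal Prod.fst).condEntropy_state_input hp ch.sum_trans₁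
  · exact Finset.sum_congr rfl fun i _ =>
      ((hout i).marginal Prod.snd).condEntropy_state_input hp ch.sum_trans₂

theorem noiseEntropy_le_blockEntropies {Cv : Outcome n M₀ M₁ M₂ S Y₁ Y₂ → C}
    (hCv : ∀ ω ω', Cv ω = Cv ω' ↔ (ω.messages, ω.s) = (ω'.messages, ω'.s)) :
    (noiseEntropy ch.trans₁ (c.stateInputMass ch),
      noiseEntropy ch.trans₂ (c.stateInputMass ch)) ≤
      c.blockEntropies ch Cv := by
  have hgap := c.csiszarGap_nonneg ch Cv
  rw [blockEntropies_eq, c.letterEntropies_congr ch hCv, letterEntropies_messages_state]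
  exact le_add_of_nonneg_right ⟨hgap, hgap⟩

variable [Nonempty M₀] [Nonempty M₁] [Nonempty M₂]

theorem smul_blockPoint_mem_splitHull (hn : n ≠ 0) :
    (n : ℝ)⁻¹ • c.blockPoint ch ∈ splitHull ch.outputEntropies := by
  rw [blockPoint_eq_sum, Finset.smul_sum]
  refine (convex_convexHull ℝ _).sum_mem (fun i _ => by positivity) (by simp [hn]) fun i _ => ?_
  refine IsChannelOutput.letterPoint_mem_splitHull (c.joint_mem_stdSimplex ch)
    (c.isChannelOutput_joint ch i fun ω b => ?_)
  exact Prod.ext (auxVar_replaceOutput (Cv := fun ω => (ω.m₀, ω.s)) (fun _ _ => rfl) ω b) rfl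

theorem sum_stateInputMass (s : S) : ∑ x, c.stateInputMass ch (s, x) = n * ch.stateP s := by
  have hletter (i : Fin n) :
      ∑ x, law (c.joint ch) (fun ω => (ω.s i, c.input ω i)) (s, x) = ch.stateP s := by
    rw [sum_law_pair_right (c.joint ch) (fun ω => ω.s i), law_state_apply]
  simp only [stateInputMass, Finset.sum_apply]
  rw [Finset.sum_comm]
  simp [hletter]

theorem le_mutualInfo_state_output (π : Y₁ × Y₂ → B) :
    n * ch.stateEntropy - equivocation (marginalKernel π ch.trans) (c.stateInputMass ch) ≤
      mutualInfo (c.joint ch) (fun ω => ω.s) fun ω i => π (ω.output i) := by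
  rw [mutualInfo, entropy_state]
  exact sub_le_sub_left (c.condEntropy_state_output_le ch π) _

theorem logb_card_m₀_le : Real.logb 2 (Fintype.card M₀) ≤
    min (outputEntropy ch.trans₁ (c.stateInputMass ch) -
        (c.blockEntropies ch fun ω => (ω.m₀, ω.s)).1)
      (outputEntropy ch.trans₂ (c.stateInputMass ch) -
        (c.blockEntropies ch fun ω => (ω.m₀, ω.s)).2) + c.fanoBound ch := by
  have hcond : Real.logb 2 (Fintype.card M₀) ≤
      condEntropy (c.joint ch) (fun ω => ω.m₀) fun ω => ω.s := by
    rw [← c.condEntropy_m₀ ch]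
    exact condEntropy_le_of_factorsThrough_right (c.joint_nonneg ch) _
      fun ω ω' h => by simp_all only [Prod.mk.injEq]
  have h₁ := hcond.trans (c.condEntropy_le_of_decoded₁ ch (fun _ _ h => (Prod.mk.inj h).1) _)
  have h₂ := hcond.trans (c.condEntropy_le_of_decoded₂ ch (fun _ _ h => (Prod.mk.inj h).1) _)
  obtain ⟨hs₁, hs₂⟩ := c.blockEntropies_state_le ch
  simp only [Channel.outputEntropies] at hs₁ hs₂
  rw [← sub_le_iff_le_add, le_min_iff]
  constructor <;> linarith

theorem logb_card_m₁_le_of_m₂ : Real.logb 2 (Fintype.card M₁) ≤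
    (c.blockEntropies ch fun ω => (ω.m₂, ω.m₀, ω.s)).1 -
      noiseEntropy ch.trans₁ (c.stateInputMass ch) + c.fanoBound ch := by
  have hnoise := (c.noiseEntropy_le_blockEntropies ch (Cv := fun ω => (ω.m₁, ω.m₂, ω.m₀, ω.s))
    fun ω ω' => by simp only [Outcome.messages, Prod.mk.injEq]; tauto).1
  have hblock := c.condEntropy_le_of_decoded₁ ch (Xv := fun ω => ω.m₁)
    (fun _ _ h => (Prod.mk.inj h).2) fun ω => (ω.m₂, ω.m₀, ω.s)
  rw [condEntropy_m₁] at hblock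
  linarith

theorem logb_card_m₂_le_of_m₁ : Real.logb 2 (Fintype.card M₂) ≤
    (c.blockEntropies ch fun ω => (ω.m₁, ω.m₀, ω.s)).2 -
      noiseEntropy ch.trans₂ (c.stateInputMass ch) + c.fanoBound ch := by
  have hnoise := (c.noiseEntropy_le_blockEntropies ch (Cv := fun ω => (ω.m₂, ω.m₁, ω.m₀, ω.s))
    fun ω ω' => by simp only [Outcome.messages, Prod.mk.injEq]; tauto).2
  have hblock := c.condEntropy_le_of_decoded₂ ch (Xv := fun ω => ω.m₂)
    (fun _ _ h => (Prod.mk.inj h).2) fun ω => (ω.m₁, ω.m₀, ω.s)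
  rw [condEntropy_m₂] at hblock
  linarith

theorem rateBounds_blockPoint {r₀ r₁ r₂ δ : ℝ} (h₀ : r₀ ≤ Real.logb 2 (Fintype.card M₀) + 1)
    (h₁ : r₁ ≤ Real.logb 2 (Fintype.card M₁) + 1) (h₂ : r₂ ≤ Real.logb 2 (Fintype.card M₂) + 1)
    (hδ : 3 + 3 * c.fanoBound ch ≤ δ) : RateBounds ch r₀ r₁ r₂ (c.blockPoint ch) δ := by
  have hΦ := c.one_le_fanoBound ch
  have hgap₀ := c.csiszarGap_nonneg ch fun ω => (ω.m₀, ω.s)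
  have hgap₀₁ := c.csiszarGap_nonneg ch fun ω => (ω.m₁, ω.m₀, ω.s)
  have hgap₀₂ := c.csiszarGap_nonneg ch fun ω => (ω.m₂, ω.m₀, ω.s)
  have hm₀ := c.logb_card_m₀_le ch
  have hm₁ := c.logb_card_m₁_le ch
  have hm₂ := c.logb_card_m₂_le ch
  have hm₁' := c.logb_card_m₁_le_of_m₂ ch
  have hm₂' := c.logb_card_m₂_le_of_m₁ ch
  simp only [blockEntropies_eq, Prod.fst_add, Prod.snd_add, ← sub_sub, min_sub_sub_right]
    at hm₀ hm₁ hm₂ hm₁' hm₂'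
  refine ⟨?_, ?_, ?_, ?_, ?_⟩ <;> dsimp only [blockPoint] <;> linarith

theorem singleLetterBounds_blockPoint (hn : n ≠ 0) {R₀ R₁ R₂ E₁ E₂ δ : ℝ}
    (h₀ : n * R₀ ≤ Real.logb 2 (Fintype.card M₀) + 1)
    (h₁ : n * R₁ ≤ Real.logb 2 (Fintype.card M₁) + 1)
    (h₂ : n * R₂ ≤ Real.logb 2 (Fintype.card M₂) + 1)
    (hE₁ : (1 / n : ℝ) * mutualInfo (c.joint ch) (fun ω => ω.s) (fun ω => ω.y₁) ≤ E₁ + δ)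
    (hE₂ : (1 / n : ℝ) * mutualInfo (c.joint ch) (fun ω => ω.s) (fun ω => ω.y₂) ≤ E₂ + δ)
    (hδ : 3 + 3 * c.fanoBound ch ≤ n * δ) :
    SingleLetterBounds ch R₀ R₁ R₂ E₁ E₂ ((n : ℝ)⁻¹ • c.blockPoint ch) δ := by
  have hn₀ : (n : ℝ) ≠ 0 := Nat.cast_ne_zero.2 hn
  have hninv : (0 : ℝ) ≤ (n : ℝ)⁻¹ := by positivity
  rw [one_div] at hE₁ hE₂
  refine ⟨fun s => ?_, ?_, ?_, ?_⟩
  · simp only [blockPoint, Prod.smul_fst, Pi.smul_apply, smul_eq_mul, ← Finset.mul_sum,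
      sum_stateInputMass, inv_mul_cancel_left₀ hn₀]
  · simpa only [inv_mul_cancel_left₀ hn₀] using (c.rateBounds_blockPoint ch h₀ h₁ h₂ hδ).smul hninv
  · refine le_trans (le_of_eq ?_) ((mul_le_mul_of_nonneg_left
      (c.le_mutualInfo_state_output ch Prod.fst) hninv).trans hE₁)
    rw [mul_sub, inv_mul_cancel_left₀ hn₀, ← equivocation_smul]
    rfl
  · refine le_trans (le_of_eq ?_) ((mul_le_mul_of_nonneg_left
      (c.le_mutualInfo_state_output ch Prod.snd) hninv).trans hE₂)
    rw [mul_sub, inv_mul_cancel_left₀ hn₀, ← equivocation_smul]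
    rfl

end Code

end Converse

section MessageSets

variable {n : ℕ} {R : ℝ}

theorem Msg.nonempty (hR : 0 ≤ R) : Nonempty (Msg n R) :=
  ⟨⟨0, Nat.floor_pos.2 (Real.one_le_rpow one_le_two (by positivity))⟩⟩

theorem logb_card_msg_le (hR : 0 ≤ R) : Real.logb 2 (Fintype.card (Msg n R)) ≤ n * R := by
  have hcard : (0 : ℝ) < Fintype.card (Msg n R) :=
    Nat.cast_pos.2 (Fintype.card_pos_iff.2 (Msg.nonempty hR))
  rw [Real.logb_le_iff_le_rpow one_lt_two hcard, Fintype.card_fin]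
  exact Nat.floor_le (by positivity)

theorem le_logb_card_msg_add_one (hR : 0 ≤ R) :
    n * R ≤ Real.logb 2 (Fintype.card (Msg n R)) + 1 := by
  have hcard : (1 : ℝ) ≤ Fintype.card (Msg n R) :=
    Nat.one_le_cast.2 (Fintype.card_pos_iff.2 (Msg.nonempty hR))
  rw [← sub_le_iff_le_add, Real.le_logb_iff_rpow_le one_lt_two (by linarith),
    Real.rpow_sub two_pos, Real.rpow_one, div_le_iff₀ two_pos]
  rw [Fintype.card_fin] at hcard ⊢
  linarith [Nat.lt_floor_add_one ((2 : ℝ) ^ ((n : ℝ) * R))]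

end MessageSets

section Conclusion

variable {S X Y₁ Y₂ : Type*} [Fintype S] [Fintype Y₁] [Fintype Y₂] {ch : Channel S X Y₁ Y₂}
  {R₀ R₁ R₂ E₁ E₂ : ℝ}

theorem Code.fanoBound_le {n : ℕ} (c : Code n (Msg n R₀) (Msg n R₁) (Msg n R₂) S X Y₁ Y₂)
    (hR₀ : 0 ≤ R₀) (hR₁ : 0 ≤ R₁) (hR₂ : 0 ≤ R₂) :
    c.fanoBound ch ≤ 1 + c.errorProb ch * (n * (R₀ + R₁ + R₂)) := by
  refine add_le_add_right (mul_le_mul_of_nonneg_left ?_ (c.errorProb_nonneg ch)) 1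
  rw [mul_add, mul_add]
  exact add_le_add (add_le_add (logb_card_msg_le hR₀) (logb_card_msg_le hR₁))
    (logb_card_msg_le hR₂)

variable [Fintype X]

theorem Achievable.exists_singleLetterBounds {φ : X → ℝ≥0} {Γ : ℝ}
    (h : Achievable ch φ Γ R₀ R₁ R₂ E₁ E₂) {δ : ℝ} (hδ : 0 < δ) :
    ∃ z ∈ splitHull ch.outputEntropies, SingleLetterBounds ch R₀ R₁ R₂ E₁ E₂ z δ := by
  obtain ⟨hR₀, hR₁, hR₂, h⟩ := h
  set R := R₀ + R₁ + R₂
  have hR_nonneg : 0 ≤ R := by positivity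
  set ε := δ / (6 * (R + 1))
  have hε : 0 < ε := by positivity
  have hεR : ε * (6 * (R + 1)) = δ := div_mul_cancel₀ _ (by positivity)
  have hεδ : ε ≤ δ := div_le_self hδ.le (by linarith [hR_nonneg])
  obtain ⟨N, hN⟩ := h ε hε
  obtain ⟨K, hK⟩ := exists_nat_gt (12 / δ)
  obtain ⟨n, hNn, hKn⟩ : ∃ n, N ≤ n ∧ K ≤ n := ⟨max N K, le_max_left N K, le_max_right N K⟩
  have hnδ : 12 < n * δ := (div_lt_iff₀ hδ).1 (hK.trans_le (Nat.cast_le.2 hKn))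
  have hn : n ≠ 0 := by
    rintro rfl
    norm_num at hnδ
  obtain ⟨c, -, herr, hE₁, hE₂⟩ := hN n hNn
  have := Msg.nonempty (n := n) hR₀
  have := Msg.nonempty (n := n) hR₁
  have := Msg.nonempty (n := n) hR₂
  have hfano : 3 + 3 * c.fanoBound ch ≤ n * δ := by
    have hbound : c.errorProb ch * (n * R) ≤ ε * (n * R) :=
      mul_le_mul_of_nonneg_right herr (by positivity)
    have hsplit : n * δ = 6 * (ε * (n * R)) + 6 * (n * ε) := by rw [← hεR]; ring
    have hnε : 0 ≤ n * ε := by positivity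
    linarith [c.fanoBound_le (ch := ch) hR₀ hR₁ hR₂]
  exact ⟨_, c.smul_blockPoint_mem_splitHull ch hn, c.singleLetterBounds_blockPoint ch hn
    (le_logb_card_msg_add_one hR₀) (le_logb_card_msg_add_one hR₁) (le_logb_card_msg_add_one hR₂)
    (hE₁.trans (by linarith)) (hE₂.trans (by linarith)) hfano⟩

variable {Ω W U V : Type*} [Fintype Ω] [Fintype W] [Fintype U] [Fintype V] {p : Ω → ℝ}
  {St : Ω → S} {In : Ω → X} {out : Ω → Y₁ × Y₂} {Wv : Ω → W} {Uv : Ω → U} {Vv : Ω → V}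

theorem rateBounds_letterPoint_iff (hp : ∀ ω, 0 ≤ p ω)
    (hout : IsChannelOutput p ch.trans St In out fun ω => (Wv ω, Uv ω, Vv ω)) {δ : ℝ} :
    RateBounds ch R₀ R₁ R₂ (letterPoint p St In out Wv Uv Vv) δ ↔
      let Y₁v := fun ω => (out ω).1
      let Y₂v := fun ω => (out ω).2
      let I_W := min (condMutualInfo p Wv Y₁v St) (condMutualInfo p Wv Y₂v St)
      let I_U := condMutualInfo p Uv Y₁v fun ω => (Wv ω, St ω)
      let I_V := condMutualInfo p Vv Y₂v fun ω => (Wv ω, St ω)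
      R₀ ≤ I_W + δ ∧
      R₀ + R₁ ≤ I_W + I_U + δ ∧
      R₀ + R₂ ≤ I_W + I_V + δ ∧
      R₀ + R₁ + R₂ ≤
        I_W + I_U + condMutualInfo p In Y₂v (fun ω => (Wv ω, Uv ω, St ω)) + δ ∧
      R₀ + R₁ + R₂ ≤
        I_W + condMutualInfo p In Y₁v (fun ω => (Wv ω, Vv ω, St ω)) + I_V + δ := by
  have hout₁ := hout.marginal Prod.fst
  have hout₂ := hout.marginal Prod.snd
  have hX₁ := (hout₁.comp fun z => (z.1, z.2.2)).condMutualInfo_input hp ch.sum_trans₁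
    (C := fun ω => (Wv ω, Vv ω, St ω)) (by simp [and_assoc])
  have hX₂ := (hout₂.comp fun z => (z.1, z.2.1)).condMutualInfo_input hp ch.sum_trans₂
    (C := fun ω => (Wv ω, Uv ω, St ω)) (by simp [and_assoc])
  rw [condEntropy_congr_right p _ (Z := fun ω => (Vv ω, Wv ω, St ω)) (by simp; tauto)] at hX₁
  rw [condEntropy_congr_right p _ (Z := fun ω => (Uv ω, Wv ω, St ω)) (by simp; tauto)] at hX₂
  simp only [hX₁, hX₂, (hout₁.comp Prod.fst).condMutualInfo_eq_outputEntropy_sub hp,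
    (hout₂.comp Prod.fst).condMutualInfo_eq_outputEntropy_sub hp,
    condMutualInfo_eq_condEntropy_sub hp Uv, condMutualInfo_eq_condEntropy_sub hp Vv]
  rfl

theorem entropy_eq_stateEntropy
    (hS : ∀ s, ∑ x, law p (fun ω => (St ω, In ω)) (s, x) = ch.stateP s) :
    entropy p St = ch.stateEntropy := by
  simp only [entropy_eq_sum_negMulLog2, Channel.stateEntropy, ← hS, sum_law_pair_right p St In]

end Conclusion

end StateMasking

end

theorem proposition2 {S X Y₁ Y₂ : Type*} [Fintype S] [Fintype X] [Fintype Y₁] [Fintype Y₂]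
    (ch : StateMasking.Channel S X Y₁ Y₂) (φ : X → NNReal) (Γ : ℝ) (hΓ : 0 < Γ)
    (R₀ R₁ R₂ E₁ E₂ : ℝ) (h : StateMasking.Achievable ch φ Γ R₀ R₁ R₂ E₁ E₂) :
    ∃ (a b c : ℕ) (P : S → Fin a × Fin b × Fin c × X → ℝ),
      (∀ s, P s ∈ stdSimplex ℝ (Fin a × Fin b × Fin c × X)) ∧
      let p := StateMasking.letterJoint ch P
      let I_W_Y₁ := StateMasking.condMutualInfo p StateMasking.rvW StateMasking.rvY₁
        StateMasking.rvS
      let I_W_Y₂ := StateMasking.condMutualInfo p StateMasking.rvW StateMasking.rvY₂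
        StateMasking.rvS
      let I_U_Y₁ := StateMasking.condMutualInfo p StateMasking.rvU StateMasking.rvY₁
        (fun ω => (StateMasking.rvW ω, StateMasking.rvS ω))
      let I_V_Y₂ := StateMasking.condMutualInfo p StateMasking.rvV StateMasking.rvY₂
        (fun ω => (StateMasking.rvW ω, StateMasking.rvS ω))
      R₀ ≤ min I_W_Y₁ I_W_Y₂ ∧
      R₀ + R₁ ≤ min I_W_Y₁ I_W_Y₂ + I_U_Y₁ ∧
      R₀ + R₂ ≤ min I_W_Y₁ I_W_Y₂ + I_V_Y₂ ∧
      R₀ + R₁ + R₂ ≤ min I_W_Y₁ I_W_Y₂ + I_U_Y₁ +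
        StateMasking.condMutualInfo p StateMasking.rvX StateMasking.rvY₂
          (fun ω => (StateMasking.rvW ω, StateMasking.rvU ω, StateMasking.rvS ω)) ∧
      R₀ + R₁ + R₂ ≤ min I_W_Y₁ I_W_Y₂ +
        StateMasking.condMutualInfo p StateMasking.rvX StateMasking.rvY₁
          (fun ω => (StateMasking.rvW ω, StateMasking.rvV ω, StateMasking.rvS ω)) + I_V_Y₂ ∧
      StateMasking.mutualInfo p StateMasking.rvS StateMasking.rvY₁ ≤ E₁ ∧
      StateMasking.mutualInfo p StateMasking.rvS StateMasking.rvY₂ ≤ E₂ := by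
  obtain ⟨z, hz, hS, hrates, hE₁, hE₂⟩ := StateMasking.exists_singleLetterBounds_zero fun δ hδ =>
    h.exists_singleLetterBounds hδ
  obtain ⟨a, b, c, P, hP, rfl⟩ := StateMasking.exists_testChannel hz hS
  have hp := StateMasking.letterJoint_nonneg ch hP
  have hout := StateMasking.isChannelOutput_letterJoint ch (P := P)
  have hinfo := (StateMasking.rateBounds_letterPoint_iff hp hout).1 hrates
  rw [add_zero, ← StateMasking.entropy_eq_stateEntropy hS] at hE₁ hE₂
  have hI₁ := ((hout.marginal Prod.fst).mutualInfo_state hp).trans_le hE₁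
  have hI₂ := ((hout.marginal Prod.snd).mutualInfo_state hp).trans_le hE₂
  simp only [add_zero] at hinfo
  obtain ⟨h₀, h₀₁, h₀₂, h₁, h₂⟩ := hinfo
  exact ⟨a, b, c, P, hP, h₀, h₀₁, h₀₂, h₁, h₂, hI₁, hI₂⟩
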